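/- **Model.** A system consists of $n$ asynchronous, sequential, crash-prone processes $p_1,\dots,p_n$ with known distinct identities; any number of them may crash. They run deterministic local algorithms and communicate only by applying atomic operations to shared objects. An object type is a tuple $(Q,Q_0,O,R,\Delta)$ (states, initial states, operations, responses, transition relation $\Delta\subseteq\Pi\times Q\times O\times R\times Q$, where $\Pi$ is the set of processes); a register is the usual atomic multi-writer multi-reader read/write object. An implementation of a type $T$ is *wait-free* if, in every execution, no process takes infinitely many steps within one operation, and *linearizable* if every finite history $H$ has a completion (responses are added to all pending invocations) that is equivalent to a legal sequential history of $T$ whose order of operations extends the real-time order $<_H$. **AllowList.** Its parameters are a set $\mathcal S$ of listable values, a set $\Pi_M\subseteq\Pi$ of managers, a set $\Pi_V\subseteq\Pi$ of verifiers, and, for every set $\mathcal A$ of values and every value $y$, an arbitrary set $\mathcal P_{\mathcal A,y}$ of valid proofs that $y\in\mathcal L_{\mathcal A}$, where $y\in\mathcal L_{\mathcal A}\iff(\mathcal A\subseteq\mathcal S\wedge y\in\mathcal A)$. A state is a pair (*listed-values*, *proofs*), where *listed-values* is a set of values and *proofs* is a set of triples (process, set of values, proof); initially both are empty. The transitions,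 for a process $p$, are: * $\mathrm{APPEND}(y)$ returns True and adds $y$ to *listed-values* if $p\in\Pi_M$ and $y\in\mathcal S$; otherwise it returns False and changes nothing. * $\mathrm{PROVE}(y)$: if $p\in\Pi_V$ and there are $\mathcal A\subseteq$ *listed-values* with $y\in\mathcal L_{\mathcal A}$ and $P\in\mathcal P_{\mathcal A,y}$, it returns some such pair $(\mathcal A,P)$ and adds $(p,\mathcal A,P)$ to *proofs*; otherwise it returns False and changes nothing. * $\mathrm{READ}()$ returns *proofs* and changes nothing. **Consensus number.** Let $V$ be a set of values with at least two elements. A one-shot consensus object has the operation $\mathrm{propose}(v)$, $v\in V$, invoked at most once by each process, subject to validity (every decided value was proposed by some process), agreement (no two processes decide differently) and termination (the implementation is wait-free). The consensus number of an object type is the largest $n$ such that a consensus object can be wait-free implemented, in a system of $n$ processes, from atomic read/write registers and objects of that type ($\infty$ if there is no largest such $n$). **Statement.** 1. For every $n$ and every choice of the parameters, the AllowList object type for $n$ processes has a wait-free linearizable implementation from finitely many atomic read/write registers. 2. The consensus number of the AllowList object type is $1$. This holds for every $V$ with at least two elements and every choice of the parameters in each system size, and also when AllowList objects with several different choices of parameters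 may be used together. -/

import Mathlib

universe u w

/-- An object type `(Q, Q₀, O, R, Δ)` shared by `n` processes, which are identified with the
elements of `Fin n`.  `Δ p q o r q'` says that when `p` applies `o` in state `q`, the object may
answer `r` and move to `q'`.  Every operation has an answer in every state. -/
structure ObjType (n : ℕ) where
  /-- states -/
  Q : Type u
  /-- initial states -/
  Q₀ : Set Q
  /-- operations -/
  O : Type u
  /-- responses -/
  R : Type u
  /-- transition relation -/
  Δ : Fin n → Q → O → R → Q → Prop
  total : ∀ p q o, ∃ r q', Δ p q o r q'

/-! ### Atomic read/write registers -/

inductive RegOp (W : Type u) : Type u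
  | read : RegOp W
  | write (w : W) : RegOp W

inductive RegRes (W : Type u) : Type u
  | val (w : W) : RegRes W
  | ack : RegRes W

inductive RegStep (n : ℕ) (W : Type u) : Fin n → W → RegOp W → RegRes W → W → Prop
  | read (p : Fin n) (x : W) : RegStep n W p x .read (.val x) x
  | write (p : Fin n) (x w : W) : RegStep n W p x (.write w) .ack w

/-- The multi-writer multi-reader atomic register with values in `W` (any initial value). -/
def register (n : ℕ) (W : Type u) : ObjType.{u} n where
  Q := W
  Q₀ := Set.univ
  O := RegOp W
  R := RegRes W
  Δ := RegStep n W
  total := by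
    intro p q o
    cases o with
    | read => exact ⟨_, _, RegStep.read p q⟩
    | write w => exact ⟨_, _, RegStep.write p q w⟩

/-! ### The AllowList object type -/

/-- The static parameters of an AllowList object in a system of `n` processes. -/
structure AllowListParams (n : ℕ) where
  /-- values that may occur as arguments of operations -/
  U : Type u
  /-- proofs -/
  Prf : Type u
  /-- the predefined set of values that can be listed -/
  S : Set U
  /-- the processes that may append -/
  managers : Set (Fin n)
  /-- the processes that may prove -/
  verifiers : Set (Fin n)
  /-- `validProofs A y` is the set of valid proofs that `y` belongs to the language of `A`
  (it need not depend on `y`, and may be anything: explicit or zero-knowledge proofs) -/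
  validProofs : Set U → U → Set Prf

namespace AllowListParams

variable {n : ℕ}

/-- The language `L_A`: set membership in a set `A` of listable values. -/
def lang (par : AllowListParams.{u} n) (A : Set par.U) : Set par.U :=
  {y | A ⊆ par.S ∧ y ∈ A}

/-- States: the set of listed values, and the set of issued proofs, each with the name of its
issuer and the set of values it refers to. -/
structure State (par : AllowListParams.{u} n) : Type u where
  listed : Set par.U
  proofs : Set (Fin n × Set par.U × par.Prf)

inductive Op (par : AllowListParams.{u} n) : Type u
  | append (y : par.U) : Op par
  | prove (y : par.U) : Op par
  | read : Op par

inductive Res (par : AllowListParams.{u} n) : Type u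
  | true : Res par
  | false : Res par
  | proof (A : Set par.U) (P : par.Prf) : Res par
  | proofs (X : Set (Fin n × Set par.U × par.Prf)) : Res par

/-- The five transitions of the AllowList object. -/
inductive Step (par : AllowListParams.{u} n) :
    Fin n → State par → Op par → Res par → State par → Prop
  | appendValid (p : Fin n) (q : State par) (y : par.U)
      (hp : p ∈ par.managers) (hy : y ∈ par.S) :
      Step par p q (.append y) .true ⟨q.listed ∪ {y}, q.proofs⟩
  | appendInvalid (p : Fin n) (q : State par) (y : par.U)
      (h : p ∉ par.managers ∨ y ∉ par.S) :
      Step par p q (.append y) .false q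
  | proveValid (p : Fin n) (q : State par) (y : par.U) (A : Set par.U) (P : par.Prf)
      (hp : p ∈ par.verifiers) (hy : y ∈ par.lang A) (hA : A ⊆ q.listed)
      (hP : P ∈ par.validProofs A y) :
      Step par p q (.prove y) (.proof A P) ⟨q.listed, q.proofs ∪ {(p, A, P)}⟩
  | proveInvalid (p : Fin n) (q : State par) (y : par.U)
      (h : ∀ (A : Set par.U) (P : par.Prf),
        y ∉ par.lang A ∨ ¬ A ⊆ q.listed ∨ P ∉ par.validProofs A y ∨ p ∉ par.verifiers) :
      Step par p q (.prove y) .false q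
  | read (p : Fin n) (q : State par) :
      Step par p q .read (.proofs q.proofs) q

end AllowListParams

/-- The AllowList object type with parameters `par`. -/
def allowList {n : ℕ} (par : AllowListParams.{u} n) : ObjType.{u} n where
  Q := par.State
  Q₀ := {⟨∅, ∅⟩}
  O := par.Op
  R := par.Res
  Δ := par.Step
  total := by
    intro p q o
    cases o with
    | append y =>
      by_cases h : p ∈ par.managers ∧ y ∈ par.S
      · exact ⟨_, _, .appendValid p q y h.1 h.2⟩
      · exact ⟨_, _, .appendInvalid p q y (not_and_or.mp h)⟩
    | prove y =>
      by_cases h : ∀ (A : Set par.U) (P : par.Prf),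
        y ∉ par.lang A ∨ ¬ A ⊆ q.listed ∨ P ∉ par.validProofs A y ∨ p ∉ par.verifiers
      · exact ⟨_, _, .proveInvalid p q y h⟩
      · push Not at h
        obtain ⟨A, P, h1, h2, h3, h4⟩ := h
        exact ⟨_, _, .proveValid p q y A P h4 h1 h2 h3⟩
    | read => exact ⟨_, _, .read p q⟩

/-! ### Histories and linearizability -/

/-- The events of a history: invocations and responses. -/
inductive Event (n : ℕ) (O R : Type u) : Type u
  | inv (p : Fin n) (o : O) : Event n O R
  | res (p : Fin n) (r : R) : Event n O R

namespace Event

variable {n : ℕ} {O R : Type u}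

/-- The process of an event. -/
def proc : Event n O R → Fin n
  | inv p _ => p
  | res p _ => p

/-- Is the event an invocation by `p`? -/
def isInv (p : Fin n) : Event n O R → Bool
  | inv p' _ => decide (p' = p)
  | res _ _ => false

/-- Is the event a response to `p`? -/
def isRes (p : Fin n) : Event n O R → Bool
  | inv _ _ => false
  | res p' _ => decide (p' = p)

end Event

section Histories

variable {n : ℕ} {O R : Type u}

/-- The sub-history `H|p`. -/
def subHistory (H : List (Event n O R)) (p : Fin n) : List (Event n O R) :=
  H.filter fun e => decide (e.proc = p)

/-- The sequential history in which the listed operations, given as (process, operation,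
response), are performed one after the other. -/
def seqHistory (S : List (Fin n × O × R)) : List (Event n O R) :=
  S.flatMap fun x => [.inv x.1 x.2.1, .res x.1 x.2.2]

/-- The order `<_H` on operations.  An operation is named by its process and its rank (from `0`)
among the operations of that process: `a <_H b` if at some moment `a` has already responded and
`b`, which occurs in `H`, has not yet been invoked. -/
def Precedes (H : List (Event n O R)) (a b : Fin n × ℕ) : Prop :=
  b.2 < H.countP (Event.isInv b.1) ∧
  ∃ H₁ H₂, H = H₁ ++ H₂ ∧
    a.2 < H₁.countP (Event.isRes a.1) ∧ H₁.countP (Event.isInv b.1) ≤ b.2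

end Histories

/-- The sequence of operations is allowed by the object type when started in state `q`. -/
inductive ObjType.Legal {n : ℕ} (T : ObjType.{u} n) : T.Q → List (Fin n × T.O × T.R) → Prop
  | nil (q : T.Q) : T.Legal q []
  | cons {p : Fin n} {q q' : T.Q} {o : T.O} {r : T.R} {S : List (Fin n × T.O × T.R)}
      (h : T.Δ p q o r q') (hS : T.Legal q' S) : T.Legal q ((p, o, r) :: S)

/-- `H` is linearizable for `T` with initial state `q₀`: some completion of `H`, obtained by adding
responses to all pending invocations, is equivalent to a legal sequential history that respects
the order of non-overlapping operations. -/
def Linearizable {n : ℕ} (T : ObjType.{u} n) (q₀ : T.Q) (H : List (Event n T.O T.R)) : Prop :=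
  ∃ (C : List (Fin n × T.R)) (S : List (Fin n × T.O × T.R)),
    T.Legal q₀ S ∧
    (∀ p, subHistory (H ++ C.map fun x => .res x.1 x.2) p = subHistory (seqHistory S) p) ∧
    ∀ a b, Precedes (H ++ C.map fun x => .res x.1 x.2) a b → Precedes (seqHistory S) a b

/-! ### Algorithms over shared base objects and their executions -/

/-- What a process does next inside an operation: apply an operation to a base object and continue
in a local state that depends on the answer, or return a response. -/
inductive LocalStep {n : ℕ} {B : Type u} (base : B → ObjType.{u} n) (R L : Type u) : Type u
  | call (b : B) (o : (base b).O) (k : (base b).R → L) : LocalStep base R L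
  | ret (r : R) (l : L) : LocalStep base R L

/-- A (deterministic) algorithm for `n` processes offering operations `O` with responses `R` on top
of atomic base objects.  Local states persist between operations. -/
structure Algorithm {n : ℕ} {B : Type u} (base : B → ObjType.{u} n) (O R : Type u) where
  /-- initial states of the base objects -/
  objInit : ∀ b, (base b).Q
  objInit_mem : ∀ b, objInit b ∈ (base b).Q₀
  /-- local states -/
  L : Type u
  localInit : Fin n → L
  /-- local state after the invocation of an operation -/
  start : Fin n → L → O → L
  /-- the next action of a process that is executing an operation -/
  next : Fin n → L → LocalStep base R L

/-- Labels of steps: invocations, responses, or an access of `p` to a base object. -/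
inductive Label (n : ℕ) (O R : Type u) : Type u
  | event (e : Event n O R) : Label n O R
  | access (p : Fin n) : Label n O R

/-- The events that a step adds to the history. -/
def Label.events {n : ℕ} {O R : Type u} : Label n O R → List (Event n O R)
  | .event e => [e]
  | .access _ => []

namespace Algorithm

variable {n : ℕ} {B : Type u} {base : B → ObjType.{u} n} {O R : Type u}

/-- A configuration: states of the base objects, local states of the processes, and whether each
process is currently executing an operation. -/
structure Config (A : Algorithm base O R) where
  obj : ∀ b, (base b).Q
  loc : Fin n → A.L
  busy : Fin n → Bool

/-- The initial configuration. -/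
def initial (A : Algorithm base O R) : A.Config where
  obj := A.objInit
  loc := A.localInit
  busy := fun _ => false

open Classical in
/-- One step of one process.  Which process moves is up to the scheduler; a crashed process is one
that is never scheduled again. -/
inductive Step (A : Algorithm base O R) : A.Config → Label n O R → A.Config → Prop
  | inv (c : A.Config) (p : Fin n) (o : O) (hb : c.busy p = false) :
      A.Step c (.event (.inv p o))
        ⟨c.obj, Function.update c.loc p (A.start p (c.loc p) o), Function.update c.busy p true⟩
  | access (c : A.Config) (p : Fin n) (b : B) (o : (base b).O) (k : (base b).R → A.L)
      (r : (base b).R) (q' : (base b).Q) (hb : c.busy p = true)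
      (hnext : A.next p (c.loc p) = .call b o k) (hΔ : (base b).Δ p (c.obj b) o r q') :
      A.Step c (.access p)
        ⟨Function.update c.obj b q', Function.update c.loc p (k r), c.busy⟩
  | res (c : A.Config) (p : Fin n) (r : R) (l : A.L) (hb : c.busy p = true)
      (hnext : A.next p (c.loc p) = .ret r l) :
      A.Step c (.event (.res p r))
        ⟨c.obj, Function.update c.loc p l, Function.update c.busy p false⟩

/-- `A.Reaches c H`: some finite execution with history `H` ends in configuration `c`. -/
inductive Reaches (A : Algorithm base O R) : A.Config → List (Event n O R) → Prop
  | initial : A.Reaches A.initial []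
  | step {c c' : A.Config} {H : List (Event n O R)} {ℓ : Label n O R}
      (h : A.Reaches c H) (hs : A.Step c ℓ c') : A.Reaches c' (H ++ ℓ.events)

/-- An infinite execution. -/
def IsExecution (A : Algorithm base O R) (c : ℕ → A.Config) (ℓ : ℕ → Label n O R) : Prop :=
  c 0 = A.initial ∧ ∀ t, A.Step (c t) (ℓ t) (c (t + 1))

/-- Wait-freedom, in all executions whose labels satisfy `ok`: no process takes infinitely many
steps inside one operation, whatever the other processes do. -/
def WaitFree (A : Algorithm base O R) (ok : (ℕ → Label n O R) → Prop) : Prop :=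
  ∀ (c : ℕ → A.Config) (ℓ : ℕ → Label n O R), A.IsExecution c ℓ → ok ℓ →
    ∀ p : Fin n, (∃ᶠ t in Filter.atTop, ℓ t = .access p) →
      ∃ᶠ t in Filter.atTop, ∃ r, ℓ t = .event (.res p r)

end Algorithm

/-- There is a wait-free linearizable implementation of an object of type `T` (with any given
initial state) from the base objects `base`. -/
def WaitFreeImplements {n : ℕ} {B : Type u} (base : B → ObjType.{u} n) (T : ObjType.{u} n) : Prop :=
  ∀ q₀ ∈ T.Q₀, ∃ A : Algorithm base T.O T.R,
    A.WaitFree (fun _ => True) ∧ ∀ c H, A.Reaches c H → Linearizable T q₀ H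

/-! ### Consensus -/

/-- `A` is a wait-free implementation of a one-shot consensus object with values in `V`; the
operation is `propose v` and the response is the decided value. -/
structure Algorithm.IsConsensus {n : ℕ} {B V : Type u} {base : B → ObjType.{u} n}
    (A : Algorithm base V V) : Prop where
  validity : ∀ c H, A.Reaches c H → (∀ p, H.countP (Event.isInv p) ≤ 1) →
    ∀ p v, Event.res p v ∈ H → ∃ p', Event.inv p' v ∈ H
  agreement : ∀ c H, A.Reaches c H → (∀ p, H.countP (Event.isInv p) ≤ 1) →
    ∀ p p' v v', Event.res p v ∈ H → Event.res p' v' ∈ H → v = v'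
  termination : A.WaitFree fun ℓ =>
    ∀ p s t v v', ℓ s = .event (.inv p v) → ℓ t = .event (.inv p v') → s = t

/-- In a system of `n` processes, consensus on values in `V` can be wait-free implemented from
atomic registers and objects of the types `T i` (any number of each). -/
def SolvesConsensus (V : Type u) (n : ℕ) {ι : Type w} (T : ι → ObjType.{u} n) : Prop :=
  ∃ (B B' : Type u) (W : B → Type u) (f : B' → ι)
    (A : Algorithm (Sum.elim (fun b => register n (W b)) (fun b' => T (f b'))) V V),
    A.IsConsensus

/-- The consensus number: the largest `n` such that consensus can be wait-free implemented from
registers and the given objects in a system of `n` processes, and `⊤` if there is no largest one.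
The objects available in a system of `n` processes are those of the types `T n i`. -/
noncomputable def consensusNumber (V : Type u) {ι : ℕ → Type w}
    (T : ∀ n, ι n → ObjType.{u} n) : ℕ∞ :=
  sSup ((fun n : ℕ => (n : ℕ∞)) '' {n | SolvesConsensus V n (T n)})

/-!
# The AllowList object is register-implementable and has consensus number one

**Implementation from registers.** An AllowList stores a set (of listed values and of issued proofs)
that only grows: by `allowListGrowingSet`, an operation that has seen a set `V` either answers from
`V` and changes nothing, or inserts one element, which it may do in every larger set as well.  So it
suffices to provide snapshots of a set that is distributed over one register per process.  Every
operation scans the registers until each of them has been found unchanged since one common moment,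
or until it has seen three changes of the same register; an operation that inserts an element
publishes the result of its own scan along with it.  Since the sets only grow, equal contents at two
moments mean no change in between, so a scan of the first kind returns the content of the object at
a moment during the operation.  In a scan of the second kind, the second change was made after the
scan began, so the operation that made the third change was invoked after that, and the view that it
published can be borrowed.  The number of accesses per operation is therefore bounded, by a rank of
the local state (`GrowingSet.waitFree`).

An operation that inserts is linearized at its write, but one that does not insert is linearized at
the moment of its snapshot, which is only known later.  A `PartialLinearization` therefore consists
of blocks, and an operation that changes nothing is put at the end of any block that is not older
than its invocation (`commit_past`).  Real-time order is respected, because everything that precedes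
the operation lies in the blocks that existed at its invocation, and because whether something
precedes an operation is settled once the latter is invoked (`precedes_of_append`).
`GrowingSet.exists_inv` maintains such a partial linearization along every execution, and
`PartialLinearization.linearizable` completes it.

**Consensus.** Any two steps of different processes on a register or on an AllowList commute, or one
of them erases the traces of the other (`ObjType.NonInterfering`).  For such objects a valency
argument excludes consensus between two processes.  By wait-freedom the accesses after the two
invocations form a well-founded relation (`IsConsensus.acc`), so a bivalent configuration would lead
to one whose successors are all univalent.  But two successors by steps of different processes have
the same valence, because some process running alone cannot tell them apart (`eq_of_univalent`), and
two successors by steps of the same process, with different answers, are both compared with a step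
of the other process.  Hence no configuration is bivalent, although at the outset each process would
decide its own value when running alone.
-/

/-! ### Object types whose operations commute or overwrite one another -/

/-- Whatever two processes are about to do in a state, and whatever answers they may get,
either the two steps commute, or one of them erases all traces of the other from the object. -/
def ObjType.NonInterfering {n : ℕ} (T : ObjType.{u} n) : Prop :=
  ∀ (p q : Fin n) (x x₁ x₂ : T.Q) (o₁ o₂ : T.O) (r₁ r₂ : T.R),
    T.Δ p x o₁ r₁ x₁ → T.Δ q x o₂ r₂ x₂ →
      (∃ y, T.Δ q x₁ o₂ r₂ y ∧ T.Δ p x₂ o₁ r₁ y) ∨ T.Δ p x₂ o₁ r₁ x₁ ∨ T.Δ q x₁ o₂ r₂ x₂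

theorem register_nonInterfering (n : ℕ) (W : Type u) : (register n W).NonInterfering := by
  intro p q x x₁ x₂ o₁ o₂ r₁ r₂ h₁ h₂
  cases h₁ with
  | read => exact .inr (.inr h₂)
  | write =>
    cases h₂ with
    | read => exact .inr (.inl (RegStep.write p x _))
    | write => exact .inr (.inl (RegStep.write p _ _))

theorem allowList_nonInterfering {n : ℕ} (par : AllowListParams.{u} n) :
    (allowList par).NonInterfering := by
  intro p q x x₁ x₂ o₁ o₂ r₁ r₂ h₁ h₂
  -- A step that leaves the state unchanged is overwritten by the other one; two steps that change
  -- the state only enlarge sets, and stay possible with the same answers when sets are enlarged.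
  cases h₁ with
  | appendInvalid => exact .inr (.inr h₂)
  | proveInvalid => exact .inr (.inr h₂)
  | read => exact .inr (.inr h₂)
  | appendValid y hp hy =>
    have h₁ : par.Step p x (.append y) .true ⟨x.listed ∪ {y}, x.proofs⟩ := .appendValid _ _ _ hp hy
    cases h₂ with
    | appendInvalid => exact .inr (.inl h₁)
    | proveInvalid => exact .inr (.inl h₁)
    | read => exact .inr (.inl h₁)
    | appendValid y' hq hy' =>
      refine .inl ⟨_, .appendValid _ _ _ hq hy', ?_⟩
      have := AllowListParams.Step.appendValid p ⟨x.listed ∪ {y'}, x.proofs⟩ y hp hy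
      rwa [Set.union_right_comm] at this
    | proveValid y' A P hq hy' hA hP =>
      exact .inl ⟨_, .proveValid _ _ _ A P hq hy' (hA.trans Set.subset_union_left) hP,
        .appendValid _ _ _ hp hy⟩
  | proveValid y A P hp hy hA hP =>
    have h₁ : par.Step p x (.prove y) (.proof A P) ⟨x.listed, x.proofs ∪ {(p, A, P)}⟩ :=
      .proveValid _ _ _ _ _ hp hy hA hP
    cases h₂ with
    | appendInvalid => exact .inr (.inl h₁)
    | proveInvalid => exact .inr (.inl h₁)
    | read => exact .inr (.inl h₁)
    | appendValid y' hq hy' =>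
      exact .inl ⟨_, .appendValid _ _ _ hq hy',
        .proveValid _ _ _ A P hp hy (hA.trans Set.subset_union_left) hP⟩
    | proveValid y' A' P' hq hy' hA' hP' =>
      refine .inl ⟨_, .proveValid _ _ _ A' P' hq hy' hA' hP', ?_⟩
      have := AllowListParams.Step.proveValid p ⟨x.listed, x.proofs ∪ {(q, A', P')}⟩ y A P hp hy
        hA hP
      rwa [Set.union_right_comm] at this

/-! ### Consensus between two processes is impossible over such objects -/

namespace Algorithm

variable {n : ℕ} {B V : Type u} {base : B → ObjType.{u} n}

/-- One of the processes `p` and `q` accesses a base object. -/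
def PairStep (A : Algorithm base V V) (p q : Fin n) (c c' : A.Config) : Prop :=
  A.Step c (.access p) c' ∨ A.Step c (.access q) c'

/-- `p` and `q` are both executing their only operation. -/
def Undecided (A : Algorithm base V V) (p q : Fin n) (c : A.Config) : Prop :=
  ∃ H, A.Reaches c H ∧ (∀ i, H.countP (Event.isInv i) ≤ 1) ∧ c.busy p = true ∧ c.busy q = true

/-- Process `p` is about to decide `v`. -/
def Returns (A : Algorithm base V V) (p : Fin n) (v : V) (c : A.Config) : Prop :=
  ∃ l, A.next p (c.loc p) = .ret v l

/-- The valence of a configuration: in some continuation in which only `p` and `q` take steps, the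
first decision is `v`. -/
def MayDecide (A : Algorithm base V V) (p q : Fin n) (v : V) (c : A.Config) : Prop :=
  ∃ c', Relation.ReflTransGen (A.PairStep p q) c c' ∧ (A.Returns p v c' ∨ A.Returns q v c')

open Classical in
/-- From object states `x` and local state `l`, process `p` may decide `v` when it runs alone. -/
inductive SoloDecides (A : Algorithm base V V) (p : Fin n) (v : V) :
    (∀ b, (base b).Q) → A.L → Prop
  | ret (x : ∀ b, (base b).Q) (l l' : A.L) (h : A.next p l = .ret v l') : A.SoloDecides p v x l
  | call (x : ∀ b, (base b).Q) (l : A.L) (b : B) (o : (base b).O) (k : (base b).R → A.L)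
      (r : (base b).R) (y : (base b).Q) (h : A.next p l = .call b o k)
      (hΔ : (base b).Δ p (x b) o r y) (hs : A.SoloDecides p v (Function.update x b y) (k r)) :
      A.SoloDecides p v x l

variable {A : Algorithm base V V} {p q : Fin n} {a b v : V} {c c' : A.Config}

theorem PairStep.symm (h : A.PairStep p q c c') : A.PairStep q p c c' := Or.symm h

theorem Undecided.symm (h : A.Undecided p q c) : A.Undecided q p c := by
  obtain ⟨H, hr, hH, hp, hq⟩ := h
  exact ⟨H, hr, hH, hq, hp⟩

theorem MayDecide.symm (h : A.MayDecide p q v c) : A.MayDecide q p v c := by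
  obtain ⟨c', hc', hr⟩ := h
  exact ⟨c', hc'.lift id fun _ _ => PairStep.symm, hr.symm⟩

theorem Undecided.step (h : A.Undecided p q c) (hs : A.PairStep p q c c') :
    A.Undecided p q c' := by
  obtain ⟨H, hr, hH, hp, hq⟩ := h
  rcases hs with hs | hs
  all_goals
    refine ⟨H, by simpa [Label.events] using hr.step hs, hH, ?_⟩
    cases hs
    exact ⟨hp, hq⟩

/-- A solo run can be carried out in every configuration that looks the same to `p`. -/
theorem SoloDecides.exists_run {x : ∀ b, (base b).Q} {l : A.L} (h : A.SoloDecides p v x l) :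
    ∀ c : A.Config, c.obj = x → c.loc p = l → c.busy p = true →
      ∃ c', Relation.ReflTransGen (fun c c' => A.Step c (.access p) c') c c' ∧
        A.Returns p v c' ∧ c'.busy p = true := by
  classical
  induction h with
  | ret x l l' h =>
    rintro c rfl rfl hb
    exact ⟨c, .refl, ⟨l', h⟩, hb⟩
  | call x l b o k r y h hΔ _ ih =>
    rintro c rfl rfl hb
    obtain ⟨c', hc', hr⟩ := ih ⟨Function.update c.obj b y, Function.update c.loc p (k r), c.busy⟩
      rfl (by simp) hb
    refine ⟨c', .head ?_ hc', hr⟩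
    convert Step.access c p b o k r y hb h hΔ

theorem SoloDecides.mayDecide (h : A.SoloDecides p v c.obj (c.loc p))
    (hb : c.busy p = true) : A.MayDecide p q v c := by
  obtain ⟨c', hc', hr, -⟩ := h.exists_run c rfl rfl hb
  exact ⟨c', hc'.lift id fun _ _ => .inl, .inl hr⟩

theorem Reaches.of_solo {H : List (Event n V V)} (hr : A.Reaches c H)
    (h : Relation.ReflTransGen (fun c c' => A.Step c (.access p) c') c c') : A.Reaches c' H := by
  induction h with
  | refl => exact hr
  | tail _ hs ih => simpa [Label.events] using ih.step hs

theorem Returns.reaches {H : List (Event n V V)} (hr : A.Reaches c H) (h : A.Returns p v c)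
    (hb : c.busy p = true) :
    ∃ c', A.Reaches c' (H ++ [.res p v]) ∧ ∀ q ≠ p, c'.loc q = c.loc q ∧ c'.busy q = c.busy q := by
  obtain ⟨l, hl⟩ := h
  exact ⟨_, by simpa [Label.events] using hr.step (Step.res c p v l hb hl), fun q hq => by
    simp [Function.update, hq]⟩

/-- A process running alone decides the only value proposed so far. -/
theorem IsConsensus.eq_of_soloDecides (hA : A.IsConsensus)
    (hs : A.Step A.initial (.event (.inv p a)) c) (h : A.SoloDecides p v c.obj (c.loc p))
    (hb : c.busy p = true) : v = a := by
  obtain ⟨c', hc', hr, hb'⟩ := h.exists_run c rfl rfl hb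
  have hreach : A.Reaches c [.inv p a] := by
    simpa [Label.events] using Reaches.initial.step hs
  obtain ⟨c₁, h₁, -⟩ := hr.reaches (hreach.of_solo hc') hb'
  obtain ⟨p', hp'⟩ := hA.validity c₁ _ h₁
    (fun i => by simp [List.countP_cons, Event.isInv]; split <;> simp) p v (by simp)
  simp only [List.cons_append, List.nil_append, List.mem_cons, Event.inv.injEq, List.not_mem_nil,
    reduceCtorEq, or_false] at hp'
  exact hp'.2

/-- If a process is about to decide, its value is the only possible decision. -/
theorem IsConsensus.eq_of_returns (hA : A.IsConsensus) (hpq : p ≠ q) {v v' : V}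
    (hc : A.Undecided p q c) (hv : A.Returns p v c) (hv' : A.MayDecide p q v' c) : v = v' := by
  obtain ⟨c', hc', hr⟩ := hv'
  induction hc' using Relation.ReflTransGen.head_induction_on with
  | refl =>
    rcases hr with ⟨l', hl'⟩ | hr
    · obtain ⟨l, hl⟩ := hv
      rw [hl] at hl'
      cases hl'
      rfl
    · obtain ⟨H, hreach, hH, hp, hq⟩ := hc
      obtain ⟨c₁, h₁, h₁'⟩ := hv.reaches hreach hp
      obtain ⟨e₁, e₂⟩ := h₁' q hpq.symm
      obtain ⟨c₂, h₂, -⟩ := Returns.reaches (p := q) (v := v') h₁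
        (by simpa [Returns, e₁] using hr) (e₂.trans hq)
      exact hA.agreement c₂ _ h₂ (fun i => by simpa [List.countP_cons, Event.isInv] using hH i)
        p q v v' (by simp) (by simp)
  | head hs _ ih =>
    refine ih (hc.step hs) ?_
    rcases hs with hs | hs
    · -- `p` cannot access an object, because it is about to decide
      obtain ⟨l, hl⟩ := hv
      cases hs with
      | access _ b o k r y hb hn hΔ =>
        rw [hn] at hl
        cases hl
    · cases hs with
      | access _ b o k r y hb hn hΔ => simpa [Returns, Function.update, hpq] using hv

/-- After the two invocations, wait-freedom rules out infinitely many accesses. -/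
theorem IsConsensus.acc (hA : A.IsConsensus) (hpq : p ≠ q) {c₁ c₂ : A.Config}
    (h₁ : A.Step A.initial (.event (.inv p a)) c₁) (h₂ : A.Step c₁ (.event (.inv q b)) c₂) :
    Acc (fun c' c => A.PairStep p q c c') c₂ := by
  by_contra hacc
  obtain ⟨f, rfl, hf⟩ := not_acc_iff_exists_descending_chain.mp hacc
  have hf' : ∀ t, ∃ i, (i = p ∨ i = q) ∧ A.Step (f t) (.access i) (f (t + 1)) := fun t =>
    (hf t).elim (fun h => ⟨p, .inl rfl, h⟩) fun h => ⟨q, .inr rfl, h⟩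
  choose π hπ hstep using hf'
  let c : ℕ → A.Config := fun t => match t with
    | 0 => A.initial
    | 1 => c₁
    | t + 2 => f t
  let ℓ : ℕ → Label n V V := fun t => match t with
    | 0 => .event (.inv p a)
    | 1 => .event (.inv q b)
    | t + 2 => .access (π t)
  have hexec : A.IsExecution c ℓ := ⟨rfl, fun t => match t with
    | 0 => h₁
    | 1 => h₂
    | t + 2 => hstep t⟩
  have hok : ∀ i s t v v', ℓ s = .event (.inv i v) → ℓ t = .event (.inv i v') → s = t := by
    intro i s t v v' hs ht
    match s, t, hs, ht with
    | 0, 0, _, _ => rfl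
    | 1, 1, _, _ => rfl
    | 0, 1, hs, ht =>
      simp only [ℓ, Label.event.injEq, Event.inv.injEq] at hs ht
      exact absurd (hs.1.trans ht.1.symm) hpq
    | 1, 0, hs, ht =>
      simp only [ℓ, Label.event.injEq, Event.inv.injEq] at hs ht
      exact absurd (ht.1.trans hs.1.symm) hpq
    | s + 2, _, hs, _ => simp [ℓ] at hs
    | 0, t + 2, _, ht => simp [ℓ] at ht
    | 1, t + 2, _, ht => simp [ℓ] at ht
  have key : ∀ i, ¬ ∃ᶠ t in Filter.atTop, π t = i := by
    intro i hi
    have hi' : ∃ᶠ t in Filter.atTop, ℓ t = .access i := by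
      rw [Filter.frequently_atTop] at hi ⊢
      intro t
      obtain ⟨s, hs, rfl⟩ := hi t
      exact ⟨s + 2, by lia, rfl⟩
    obtain ⟨t, r, ht⟩ := (hA.termination c ℓ hexec hok i hi').exists
    match t, ht with
    | 0, ht => simp [ℓ] at ht
    | 1, ht => simp [ℓ] at ht
    | t + 2, ht => simp [ℓ] at ht
  have h : ∃ᶠ t in Filter.atTop, π t = p ∨ π t = q := Filter.Frequently.of_forall hπ
  exact (Filter.frequently_or_distrib.mp h).elim (key p) (key q)

theorem exists_access_or_returns (i : Fin n) (hb : c.busy i = true) :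
    (∃ v, A.Returns i v c) ∨ ∃ c', A.Step c (.access i) c' := by
  cases h : A.next i (c.loc i) with
  | ret v l => exact .inl ⟨v, l, h⟩
  | call b o k =>
    obtain ⟨r, y, hΔ⟩ := (base b).total i (c.obj b) o
    exact .inr ⟨_, Step.access c i b o k r y hb h hΔ⟩

theorem exists_soloDecides (hacc : Acc (fun c' c => A.PairStep p q c c') c)
    (hb : c.busy p = true) : ∃ v, A.SoloDecides p v c.obj (c.loc p) := by
  induction hacc with
  | intro c _ ih =>
    rcases exists_access_or_returns p hb with ⟨v, l, h⟩ | ⟨c', hs⟩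
    · exact ⟨v, .ret _ _ l h⟩
    · have hs' := hs
      cases hs with
      | access _ b o k r y _ hn hΔ =>
        obtain ⟨v, hv⟩ := ih _ (.inl hs') hb
        exact ⟨v, .call _ _ b o k r y hn hΔ (by simpa using hv)⟩

theorem acc_pairStep_symm (h : Acc (fun c' c => A.PairStep p q c c') c) :
    Acc (fun c' c => A.PairStep q p c c') c := by
  have : (fun c' c => A.PairStep q p c c') = fun c' c => A.PairStep p q c c' := by
    funext c' c
    exact propext ⟨.symm, .symm⟩
  rwa [this]

/-- Two univalent configurations that arise from the same configuration by steps of `p` and of `q`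
have the same valence: after the two steps in either order, or after only one of them, one of the
two processes cannot tell the difference and decides the same value when it runs alone. -/
theorem eq_of_univalent (hT : ∀ b, (base b).NonInterfering) (hpq : p ≠ q) {c₁ c₂ : A.Config}
    {v₁ v₂ : V} (hacc : Acc (fun c' c => A.PairStep p q c c') c)
    (h₁ : A.Step c (.access p) c₁) (h₂ : A.Step c (.access q) c₂)
    (hv₁ : ∀ v, A.MayDecide p q v c₁ → v = v₁) (hv₂ : ∀ v, A.MayDecide p q v c₂ → v = v₂) :
    v₁ = v₂ := by
  classical
  have hacc₁ := hacc.inv (.inl h₁)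
  have hacc₂ := hacc.inv (.inr h₂)
  have of_solo : ∀ {i : Fin n} {v : V} {c c' : A.Config}, (i = p ∨ i = q) →
      c.busy i = true → A.PairStep p q c c' → A.SoloDecides i v c'.obj (c'.loc i) →
      A.MayDecide p q v c := by
    intro i v c c' hi hb hs h
    have hb' : c'.busy i = true := by
      rcases hs with hs | hs <;> cases hs <;> exact hb
    have : A.MayDecide p q v c' := by
      rcases hi with rfl | rfl
      · exact h.mayDecide hb'
      · exact (h.mayDecide hb').symm
    obtain ⟨c'', hc'', hr⟩ := this
    exact ⟨c'', .head hs hc'', hr⟩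
  have of_common : ∀ c₃, c₁.busy p = true → c₂.busy p = true →
      c₃.busy p = true → A.Step c₁ (.access q) c₃ → A.Step c₂ (.access p) c₃ → v₁ = v₂ := by
    intro c₃ hb₁ hb₂ hb₃ h₁₃ h₂₃
    obtain ⟨v, hv⟩ := exists_soloDecides (hacc₁.inv (.inr h₁₃)) hb₃
    exact (hv₁ v (of_solo (.inl rfl) hb₁ (.inr h₁₃) hv)).symm.trans
      (hv₂ v (of_solo (.inl rfl) hb₂ (.inl h₂₃) hv))
  cases h₁ with
  | access _ b₁ o₁ k₁ r₁ y₁ hp hn₁ hΔ₁ =>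
  cases h₂ with
  | access _ b₂ o₂ k₂ r₂ y₂ hq hn₂ hΔ₂ =>
  by_cases hb : b₁ = b₂
  · subst hb
    rcases hT b₁ p q _ _ _ _ _ _ _ hΔ₁ hΔ₂ with ⟨z, hz₂, hz₁⟩ | h | h
    · refine of_common ⟨Function.update c.obj b₁ z,
        Function.update (Function.update c.loc p (k₁ r₁)) q (k₂ r₂), c.busy⟩ hp hp hp ?_ ?_
      · have := Step.access (A := A) ⟨Function.update c.obj b₁ y₁, Function.update c.loc p (k₁ r₁),
          c.busy⟩ q b₁ o₂ k₂ r₂ z hq (by simpa [hpq.symm] using hn₂) (by simpa using hz₂)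
        simpa using this
      · have := Step.access (A := A) ⟨Function.update c.obj b₁ y₂, Function.update c.loc q (k₂ r₂),
          c.busy⟩ p b₁ o₁ k₁ r₁ z hp (by simpa [hpq] using hn₁) (by simpa using hz₁)
        rw [Function.update_comm hpq.symm] at this
        simpa using this
    · obtain ⟨v, hv⟩ := exists_soloDecides hacc₁ hp
      refine (hv₁ v (hv.mayDecide hp)).symm.trans (hv₂ v ?_)
      refine of_solo (.inl rfl) hp (.inl (Step.access _ p b₁ o₁ k₁ r₁ y₁ hp ?_ ?_)) ?_
      · simpa [hpq] using hn₁
      · simpa using h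
      · simpa [hpq] using hv
    · obtain ⟨v, hv⟩ := exists_soloDecides (acc_pairStep_symm hacc₂) hq
      refine (hv₁ v ?_).symm.trans (hv₂ v (hv.mayDecide hq).symm)
      refine of_solo (.inr rfl) hq (.inr (Step.access _ q b₁ o₂ k₂ r₂ y₂ hq ?_ ?_)) ?_
      · simpa [hpq.symm] using hn₂
      · simpa using h
      · simpa [hpq.symm] using hv
  · refine of_common ⟨Function.update (Function.update c.obj b₁ y₁) b₂ y₂,
      Function.update (Function.update c.loc p (k₁ r₁)) q (k₂ r₂), c.busy⟩ hp hp hp ?_ ?_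
    · exact Step.access ⟨Function.update c.obj b₁ y₁, Function.update c.loc p (k₁ r₁),
        c.busy⟩ q b₂ o₂ k₂ r₂ y₂ hq (by simpa [hpq.symm] using hn₂)
        (by simpa [Function.update_of_ne (Ne.symm hb)] using hΔ₂)
    · have := Step.access (A := A) ⟨Function.update c.obj b₂ y₂, Function.update c.loc q (k₂ r₂),
        c.busy⟩ p b₁ o₁ k₁ r₁ y₁ hp (by simpa [hpq] using hn₁)
        (by simpa [Function.update_of_ne hb] using hΔ₁)
      rwa [Function.update_comm (f := c.loc) hpq.symm,
        Function.update_comm (f := c.obj) (Ne.symm hb)] at this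

/-- No reachable configuration is bivalent: every step from a minimal bivalent one would lead to a
univalent one, against `eq_of_univalent`. -/
theorem IsConsensus.eq_of_mayDecide (hA : A.IsConsensus) (hT : ∀ b, (base b).NonInterfering)
    (hpq : p ≠ q) {v v' : V} (hacc : Acc (fun c' c => A.PairStep p q c c') c)
    (hc : A.Undecided p q c) (hv : A.MayDecide p q v c) (hv' : A.MayDecide p q v' c) :
    v = v' := by
  induction hacc generalizing v v' with
  | intro c hacc ih =>
  have hacc' : Acc (fun c' c => A.PairStep p q c c') c := ⟨_, hacc⟩
  obtain ⟨hp, hq⟩ : c.busy p = true ∧ c.busy q = true := by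
    obtain ⟨H, -, -, hp, hq⟩ := hc
    exact ⟨hp, hq⟩
  rcases exists_access_or_returns p hp with ⟨w, hw⟩ | ⟨c₁, h₁⟩
  · exact (hA.eq_of_returns hpq hc hw hv).symm.trans (hA.eq_of_returns hpq hc hw hv')
  rcases exists_access_or_returns q hq with ⟨w, hw⟩ | ⟨c₂, h₂⟩
  · exact (hA.eq_of_returns hpq.symm hc.symm hw hv.symm).symm.trans
      (hA.eq_of_returns hpq.symm hc.symm hw hv'.symm)
  have not_returns : ∀ {i : Fin n} {c' : A.Config} {w : V}, A.Step c (.access i) c' →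
      ¬ A.Returns i w c := by
    rintro i c' w hs ⟨l, hl⟩
    cases hs with
    | access _ b o k r y hb hn hΔ =>
      rw [hn] at hl
      cases hl
  have exists_succ : ∀ {w : V}, A.MayDecide p q w c →
      ∃ c', A.PairStep p q c c' ∧ A.MayDecide p q w c' := by
    rintro w ⟨c', hc', hr⟩
    rcases Relation.ReflTransGen.cases_head hc' with rfl | ⟨d, hd, hd'⟩
    · exact (hr.elim (not_returns h₁) (not_returns h₂)).elim
    · exact ⟨d, hd, c', hd', hr⟩
  have exists_mayDecide : ∀ {c'}, A.PairStep p q c c' → ∃ w, A.MayDecide p q w c' := by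
    intro c' hs
    have hb : c'.busy p = true := (hc.step hs).choose_spec.2.2.1
    obtain ⟨w, hw⟩ := exists_soloDecides (hacc c' hs) hb
    exact ⟨w, hw.mayDecide hb⟩
  have eq_of_steps : ∀ {d d' : A.Config} {w w' : V}, A.Step c (.access p) d →
      A.Step c (.access q) d' → A.MayDecide p q w d → A.MayDecide p q w' d' → w = w' :=
    fun hd hd' hw hw' => eq_of_univalent hT hpq hacc' hd hd'
      (fun _ h => ih _ (.inl hd) (hc.step (.inl hd)) h hw)
      (fun _ h => ih _ (.inr hd') (hc.step (.inr hd')) h hw')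
  obtain ⟨d, hd, hdv⟩ := exists_succ hv
  obtain ⟨d', hd', hdv'⟩ := exists_succ hv'
  -- Different answers to the same access are compared through a step of the other process.
  rcases hd with hd | hd <;> rcases hd' with hd' | hd'
  · obtain ⟨w, hw⟩ := exists_mayDecide (.inr h₂)
    exact (eq_of_steps hd h₂ hdv hw).trans (eq_of_steps hd' h₂ hdv' hw).symm
  · exact eq_of_steps hd hd' hdv hdv'
  · exact (eq_of_steps hd' hd hdv' hdv).symm
  · obtain ⟨w, hw⟩ := exists_mayDecide (.inl h₁)
    exact (eq_of_steps h₁ hd hw hdv).symm.trans (eq_of_steps h₁ hd' hw hdv')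

theorem not_isConsensus [Nontrivial V] (hT : ∀ b, (base b).NonInterfering) (hpq : p ≠ q) :
    ¬ A.IsConsensus := by
  classical
  intro hA
  obtain ⟨a, b, hab⟩ := exists_pair_ne V
  have invoke : ∀ i v, ∃ c, A.Step A.initial (.event (.inv i v)) c ∧ c.obj = A.objInit ∧
      c.loc i = A.start i (A.localInit i) v ∧ c.busy i = true := fun i v =>
    ⟨_, Step.inv A.initial i v rfl, rfl, by simp [initial], by simp⟩
  have both : ∃ c₁ c₂, A.Step A.initial (.event (.inv p a)) c₁ ∧
      A.Step c₁ (.event (.inv q b)) c₂ ∧ c₂.obj = A.objInit ∧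
      c₂.loc p = A.start p (A.localInit p) a ∧ c₂.loc q = A.start q (A.localInit q) b ∧
      c₂.busy p = true ∧ c₂.busy q = true :=
    ⟨_, _, Step.inv A.initial p a rfl, Step.inv _ q b (by simp [initial, hpq.symm]), rfl,
      by simp [initial, hpq], by simp [initial, hpq.symm], by simp [hpq], by simp⟩
  obtain ⟨c₁, c₂, h₁, h₂, hobj, hlp, hlq, hbp, hbq⟩ := both
  have hacc := hA.acc hpq h₁ h₂
  have hc : A.Undecided p q c₂ := by
    refine ⟨[.inv p a, .inv q b], ?_, fun i => ?_, hbp, hbq⟩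
    · simpa [Label.events] using (Reaches.initial.step h₁).step h₂
    · by_cases hi : p = i
      · subst hi
        simp [Event.isInv, hpq.symm]
      · simp [List.countP_cons, Event.isInv, hi]
        split <;> simp
  -- Each of the two can decide its own value, since it may run alone before the other one starts.
  obtain ⟨v, hv⟩ := exists_soloDecides hacc hbp
  obtain ⟨w, hw⟩ := exists_soloDecides (acc_pairStep_symm hacc) hbq
  have hvw : v = w :=
    hA.eq_of_mayDecide hT hpq hacc hc (hv.mayDecide hbp) (hw.mayDecide hbq).symm
  obtain ⟨d, hd, hdo, hdl, hdb⟩ := invoke p a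
  obtain ⟨e, he, heo, hel, heb⟩ := invoke q b
  have hva : v = a := hA.eq_of_soloDecides hd (by rwa [hdo, hdl, ← hobj, ← hlp]) hdb
  have hwb : w = b := hA.eq_of_soloDecides he (by rwa [heo, hel, ← hobj, ← hlq]) heb
  exact hab (hva.symm.trans (hvw.trans hwb))

end Algorithm

/-! ### The consensus number -/

theorem not_solvesConsensus (V : Type u) [Nontrivial V] {n : ℕ} (hn : 2 ≤ n) {ι : Type w}
    {T : ι → ObjType.{u} n} (hT : ∀ i, (T i).NonInterfering) : ¬ SolvesConsensus V n T := by
  rintro ⟨B, B', W, f, A, hA⟩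
  refine Algorithm.not_isConsensus (p := ⟨0, by lia⟩) (q := ⟨1, by lia⟩) ?_ (by simp) hA
  rintro (b | b)
  · exact register_nonInterfering n (W b)
  · exact hT (f b)

/-- A single process decides its own value. -/
theorem solvesConsensus_one (V : Type u) [Nonempty V] {ι : Type w} (T : ι → ObjType.{u} 1) :
    SolvesConsensus V 1 T := by
  classical
  let A : Algorithm (Sum.elim (fun b : PEmpty.{u + 1} => register 1 (PEmpty.elim b : Type u))
      (fun b : PEmpty.{u + 1} => T (b.elim))) V V :=
    { objInit := fun b => b.elim PEmpty.elim PEmpty.elim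
      objInit_mem := fun b => b.elim (fun b => b.elim) (fun b => b.elim)
      L := V
      localInit := fun _ => Classical.arbitrary V
      start := fun _ _ v => v
      next := fun _ v => .ret v v }
  have inv : ∀ c H, A.Reaches c H → (∀ p, c.busy p = true → Event.inv p (c.loc p) ∈ H) ∧
      ∀ p v, Event.res p v ∈ H → Event.inv p v ∈ H := by
    intro c H h
    induction h with
    | initial => simp [Algorithm.initial]
    | step h hs ih =>
      obtain ⟨ih₁, ih₂⟩ := ih
      cases hs with
      | inv p v hb =>
        refine ⟨fun q _ => ?_, fun q w hw => ?_⟩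
        · obtain rfl := Subsingleton.elim p q
          simp [Label.events, A]
        · simp only [Label.events, List.mem_append, List.mem_singleton, reduceCtorEq,
            or_false] at hw ⊢
          exact .inl (ih₂ q w hw)
      | access p b => exact b.elim (fun b => b.elim) (fun b => b.elim)
      | res p v l hb hn =>
        have hv : _ = v ∧ _ = l := LocalStep.ret.inj hn
        refine ⟨fun q hq => ?_, fun q w hw => ?_⟩
        · obtain rfl := Subsingleton.elim p q
          simp at hq
        · simp only [Label.events, List.mem_append, List.mem_singleton, Event.res.injEq,
            reduceCtorEq, or_false] at hw ⊢
          rcases hw with hw | ⟨rfl, rfl⟩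
          · exact ih₂ q w hw
          · rw [← hv.1]
            exact ih₁ _ hb
  refine ⟨PEmpty, PEmpty, fun b => b.elim, fun b => b.elim, A, ?_, ?_, ?_⟩
  · intro c H h _ p v hv
    exact ⟨p, (inv c H h).2 p v hv⟩
  · intro c H h hH p p' v v' hv hv'
    obtain rfl := Subsingleton.elim p p'
    have h₁ := (inv c H h).2 p v hv
    have h₂ := (inv c H h).2 p v' hv'
    have hlen := hH p
    rw [List.countP_eq_length_filter] at hlen
    have m₁ : Event.inv p v ∈ H.filter (Event.isInv p) :=
      List.mem_filter.mpr ⟨h₁, by simp [Event.isInv]⟩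
    have m₂ : Event.inv p v' ∈ H.filter (Event.isInv p) :=
      List.mem_filter.mpr ⟨h₂, by simp [Event.isInv]⟩
    rcases hl : H.filter (Event.isInv p) with _ | ⟨x, _ | ⟨y, t⟩⟩
    · simp [hl] at m₁
    · simp only [hl, List.mem_singleton] at m₁ m₂
      simpa using m₁.trans m₂.symm
    · simp [hl] at hlen
  · intro c ℓ h _ p hp
    obtain ⟨t, ht⟩ := hp.exists
    have hs := h.2 t
    generalize c (t + 1) = c' at hs
    rw [ht] at hs
    cases hs with
    | access _ b => exact b.elim (fun b => b.elim) (fun b => b.elim)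

theorem consensusNumber_eq_one (V : Type u) [Nontrivial V] {ι : ℕ → Type w}
    (T : ∀ n, ι n → ObjType.{u} n) (hT : ∀ n i, (T n i).NonInterfering) :
    consensusNumber V T = 1 := by
  apply le_antisymm
  · apply sSup_le
    rintro _ ⟨n, hn, rfl⟩
    by_contra h
    refine not_solvesConsensus V ?_ (hT n) hn
    by_contra h'
    exact h (Nat.cast_le_one.mpr (by lia))
  · exact le_sSup ⟨1, solvesConsensus_one V _, by simp⟩

/-! ### Retroactive linearization -/

/-- `T.Run q S q'`: performing the operations `S` can take the object from state `q` to `q'`. -/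
inductive ObjType.Run {n : ℕ} (T : ObjType.{u} n) :
    T.Q → List (Fin n × T.O × T.R) → T.Q → Prop
  | nil (q : T.Q) : T.Run q [] q
  | cons {p : Fin n} {q q' q'' : T.Q} {o : T.O} {r : T.R} {S : List (Fin n × T.O × T.R)}
      (h : T.Δ p q o r q') (hS : T.Run q' S q'') : T.Run q ((p, o, r) :: S) q''

/-- What the history and the linearization know about a process: it is idle, or its current
operation has not been linearized yet, or it has been linearized with response `r`. -/
inductive Status (O R : Type u) : Type u
  | idle : Status O R
  | pending (o : O) : Status O R
  | committed (r : R) : Status O R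

namespace Linearization

variable {n : ℕ} {O R : Type u}

/-- The number of operations of `p` in `S`. -/
def cnt (p : Fin n) (S : List (Fin n × O × R)) : ℕ := S.countP fun x => decide (x.1 = p)

/-- The operations in the blocks `0, …, j`. -/
def upTo (blk : ℕ → List (Fin n × O × R)) (j : ℕ) : List (Fin n × O × R) :=
  (List.range (j + 1)).flatMap blk

/-- Operation `a` comes before operation `b` in the sequence `S`; operations are named by process
and rank, as in `Precedes`. -/
def Before (S : List (Fin n × O × R)) (a b : Fin n × ℕ) : Prop :=
  ∃ S₁ S₂, S = S₁ ++ S₂ ∧ a.2 < cnt a.1 S₁ ∧ cnt b.1 S₁ ≤ b.2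

theorem cnt_append (p : Fin n) (S S' : List (Fin n × O × R)) :
    cnt p (S ++ S') = cnt p S + cnt p S' := List.countP_append

theorem cnt_cons (p : Fin n) (x : Fin n × O × R) (S : List (Fin n × O × R)) :
    cnt p (x :: S) = cnt p S + if x.1 = p then 1 else 0 := by
  simp [cnt, List.countP_cons]

theorem cnt_eq_zero {p : Fin n} {S : List (Fin n × O × R)} (h : ∀ x ∈ S, x.1 ≠ p) :
    cnt p S = 0 := by
  simpa [cnt, List.countP_eq_zero] using h

theorem seqHistory_append (S S' : List (Fin n × O × R)) :
    seqHistory (S ++ S') = seqHistory S ++ seqHistory S' := List.flatMap_append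

theorem seqHistory_cons (x : Fin n × O × R) (S : List (Fin n × O × R)) :
    seqHistory (x :: S) = .inv x.1 x.2.1 :: .res x.1 x.2.2 :: seqHistory S := rfl

theorem countP_isInv_seqHistory (p : Fin n) (S : List (Fin n × O × R)) :
    (seqHistory S).countP (Event.isInv p) = cnt p S := by
  induction S with
  | nil => rfl
  | cons x S ih => simp [seqHistory_cons, List.countP_cons, Event.isInv, cnt_cons, ih]

theorem countP_isRes_seqHistory (p : Fin n) (S : List (Fin n × O × R)) :
    (seqHistory S).countP (Event.isRes p) = cnt p S := by
  induction S with
  | nil => rfl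
  | cons x S ih => simp [seqHistory_cons, List.countP_cons, Event.isRes, cnt_cons, ih]

theorem subHistory_append (H H' : List (Event n O R)) (p : Fin n) :
    subHistory (H ++ H') p = subHistory H p ++ subHistory H' p := List.filter_append ..

theorem countP_isInv_subHistory (p : Fin n) (H : List (Event n O R)) :
    (subHistory H p).countP (Event.isInv p) = H.countP (Event.isInv p) := by
  rw [subHistory, List.countP_filter]
  congr 1
  funext e
  cases e <;> simp +contextual [Event.isInv, Event.proc]

theorem countP_isRes_subHistory (p : Fin n) (H : List (Event n O R)) :
    (subHistory H p).countP (Event.isRes p) = H.countP (Event.isRes p) := by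
  rw [subHistory, List.countP_filter]
  congr 1
  funext e
  cases e <;> simp +contextual [Event.isRes, Event.proc]

theorem subHistory_seqHistory_of_ne {p : Fin n} {S : List (Fin n × O × R)}
    (h : ∀ x ∈ S, x.1 ≠ p) : subHistory (seqHistory S) p = [] := by
  simp only [subHistory, seqHistory, List.filter_eq_nil_iff, List.mem_flatMap]
  rintro e ⟨x, hx, he⟩
  simp only [List.mem_cons, List.not_mem_nil, or_false] at he
  rcases he with rfl | rfl <;> simp [Event.proc, h x hx]

theorem Before.precedes {S : List (Fin n × O × R)} {a b : Fin n × ℕ} (h : Before S a b)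
    (hb : b.2 < cnt b.1 S) : Precedes (seqHistory S) a b := by
  obtain ⟨S₁, S₂, rfl, ha, hb'⟩ := h
  refine ⟨by rwa [countP_isInv_seqHistory], seqHistory S₁, seqHistory S₂,
    seqHistory_append _ _, ?_, ?_⟩
  · rwa [countP_isRes_seqHistory]
  · rwa [countP_isInv_seqHistory]

/-- Inserting an operation behind all operations of its process preserves the order. -/
theorem Before.insert {P Q : List (Fin n × O × R)} {z : Fin n × O × R} {a b : Fin n × ℕ}
    (h : Before (P ++ Q) a b) (hb : b.2 < cnt b.1 (P ++ Q)) (hQ : ∀ x ∈ Q, x.1 ≠ z.1) :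
    Before (P ++ z :: Q) a b := by
  obtain ⟨S₁, S₂, hS, ha, hb'⟩ := h
  rw [List.append_eq_append_iff] at hS
  rcases hS with ⟨Q₁, rfl, rfl⟩ | ⟨P₂, rfl, rfl⟩
  · refine ⟨P ++ z :: Q₁, S₂, by simp, ?_, ?_⟩
    · rw [cnt_append, cnt_cons]
      rw [cnt_append] at ha
      lia
    · rw [cnt_append, cnt_cons]
      rw [cnt_append] at hb hb'
      by_cases hz : z.1 = b.1
      · rw [cnt_eq_zero (S := Q₁ ++ S₂) (hz ▸ hQ)] at hb
        lia
      · simpa [hz] using hb'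
  · exact ⟨S₁, P₂ ++ z :: Q, by simp, ha, hb'⟩

/-- Whether an operation precedes an operation that has been invoked is settled. -/
theorem precedes_of_append {H H' : List (Event n O R)} {a b : Fin n × ℕ}
    (h : Precedes (H ++ H') a b) (hb : b.2 < H.countP (Event.isInv b.1)) : Precedes H a b := by
  obtain ⟨-, H₁, H₂, hH, ha, hb'⟩ := h
  rw [List.append_eq_append_iff] at hH
  rcases hH with ⟨t, rfl, rfl⟩ | ⟨t, rfl, rfl⟩
  · rw [List.countP_append] at hb'
    lia
  · exact ⟨hb, H₁, t, rfl, ha, hb'⟩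

theorem lt_of_precedes {H : List (Event n O R)} {a b : Fin n × ℕ} (h : Precedes H a b) :
    a.2 < H.countP (Event.isRes a.1) := by
  obtain ⟨-, H₁, H₂, rfl, ha, -⟩ := h
  rw [List.countP_append]
  lia

theorem upTo_succ (blk : ℕ → List (Fin n × O × R)) (j : ℕ) :
    upTo blk (j + 1) = upTo blk j ++ blk (j + 1) := by
  simp [upTo, List.range_succ]

theorem cnt_upTo_mono (p : Fin n) (blk : ℕ → List (Fin n × O × R)) {j k : ℕ} (h : j ≤ k) :
    cnt p (upTo blk j) ≤ cnt p (upTo blk k) := by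
  induction h with
  | refl => rfl
  | step _ ih =>
    rw [Nat.succ_eq_add_one, upTo_succ, cnt_append]
    lia

theorem upTo_congr {blk blk' : ℕ → List (Fin n × O × R)} {j : ℕ}
    (h : ∀ i ≤ j, blk i = blk' i) : upTo blk j = upTo blk' j := by
  induction j with
  | zero => simp [upTo, h]
  | succ j ih => rw [upTo_succ, upTo_succ, ih fun i hi => h i (by lia), h _ le_rfl]

theorem upTo_split (blk : ℕ → List (Fin n × O × R)) {j N : ℕ} (h : j ≤ N)
    (z : Fin n × O × R) :
    ∃ Q, upTo blk N = upTo blk j ++ Q ∧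
      upTo (Function.update blk j (blk j ++ [z])) N = upTo blk j ++ z :: Q ∧
      ∀ x ∈ Q, ∃ i, j < i ∧ i ≤ N ∧ x ∈ blk i := by
  induction N, h using Nat.le_induction with
  | base =>
    refine ⟨[], by simp, ?_, by simp⟩
    cases j with
    | zero => simp [upTo]
    | succ j =>
      rw [upTo_succ, upTo_succ, upTo_congr (blk' := blk)
        fun i hi => Function.update_of_ne (by lia) _ _]
      simp
  | succ N hN ih =>
    obtain ⟨Q, h₁, h₂, h₃⟩ := ih
    refine ⟨Q ++ blk (N + 1), ?_, ?_, fun x hx => ?_⟩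
    · rw [upTo_succ, h₁, List.append_assoc]
    · rw [upTo_succ, h₂, Function.update_of_ne (by lia)]
      simp
    · rcases List.mem_append.mp hx with hx | hx
      · obtain ⟨i, hi, hi', hx⟩ := h₃ x hx
        exact ⟨i, hi, by lia, hx⟩
      · exact ⟨N + 1, by lia, le_rfl, hx⟩

end Linearization

open Linearization

theorem ObjType.Run.append {n : ℕ} {T : ObjType.{u} n} {q q' q'' : T.Q}
    {S S' : List (Fin n × T.O × T.R)} (h : T.Run q S q') (h' : T.Run q' S' q'') :
    T.Run q (S ++ S') q'' := by
  induction h with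
  | nil => exact h'
  | cons hΔ _ ih => exact .cons hΔ (ih h')

theorem ObjType.Run.legal {n : ℕ} {T : ObjType.{u} n} {q q' : T.Q}
    {S : List (Fin n × T.O × T.R)} (h : T.Run q S q') : T.Legal q S := by
  induction h with
  | nil => exact .nil _
  | cons hΔ _ ih => exact .cons hΔ ih

/-- A linearization under construction for the history `H`.  It is cut into blocks `0, …, N`, where
block `j` leaves the object in state `st j`.  When a process invokes an operation, `start` records
the last block that exists at this moment; the operation may later be linearized at the end of this
block or of any newer one. -/
structure PartialLinearization {n : ℕ} (T : ObjType.{u} n) (q₀ : T.Q) (H : List (Event n T.O T.R))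
    (N : ℕ) (st : ℕ → T.Q) (blk : ℕ → List (Fin n × T.O × T.R)) (start : Fin n → ℕ)
    (stat : Fin n → Status T.O T.R) : Prop where
  run_zero : T.Run q₀ (blk 0) (st 0)
  run_succ : ∀ j < N, T.Run (st j) (blk (j + 1)) (st (j + 1))
  start_le : ∀ p, start p ≤ N
  idle : ∀ p, stat p = .idle → subHistory H p = subHistory (seqHistory (upTo blk N)) p
  pending : ∀ p o, stat p = .pending o →
    subHistory H p = subHistory (seqHistory (upTo blk N)) p ++ [.inv p o]
  committed : ∀ p r, stat p = .committed r →
    subHistory H p ++ [.res p r] = subHistory (seqHistory (upTo blk N)) p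
  /-- blocks that are newer than a pending operation contain no operation of the same process -/
  newer : ∀ p o, stat p = .pending o → ∀ j, start p < j → j ≤ N → ∀ x ∈ blk j, x.1 ≠ p
  before : ∀ a b, Precedes H a b → b.2 < cnt b.1 (upTo blk N) → Before (upTo blk N) a b
  /-- whatever precedes a pending operation lies in the blocks that existed at its invocation -/
  older : ∀ p o, stat p = .pending o → ∀ a, Precedes H a (p, cnt p (upTo blk N)) →
    a.2 < cnt a.1 (upTo blk (start p))

namespace PartialLinearization

variable {n : ℕ} {T : ObjType.{u} n} {q₀ : T.Q} {H : List (Event n T.O T.R)} {N : ℕ}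
  {st : ℕ → T.Q} {blk : ℕ → List (Fin n × T.O × T.R)} {start : Fin n → ℕ}
  {stat : Fin n → Status T.O T.R}

theorem initial (T : ObjType.{u} n) (q₀ : T.Q) :
    PartialLinearization T q₀ [] 0 (fun _ => q₀) (fun _ => []) (fun _ => 0) fun _ => .idle where
  run_zero := .nil _
  run_succ := by simp
  start_le := by simp
  idle := by simp [upTo, seqHistory]
  pending := by simp
  committed := by simp
  newer := by simp
  before := by simp [upTo, cnt]
  older := by simp

theorem countP_isInv (h : PartialLinearization T q₀ H N st blk start stat) (p : Fin n) :
    H.countP (Event.isInv p) =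
      cnt p (upTo blk N) + match stat p with | .pending _ => 1 | _ => 0 := by
  rw [← countP_isInv_subHistory]
  cases hp : stat p with
  | idle => simp [h.idle p hp, countP_isInv_subHistory, countP_isInv_seqHistory]
  | pending o =>
    rw [h.pending p o hp, List.countP_append, countP_isInv_subHistory, countP_isInv_seqHistory]
    simp [Event.isInv]
  | committed r =>
    have := congrArg (List.countP (Event.isInv p)) (h.committed p r hp)
    rw [List.countP_append, countP_isInv_subHistory p (seqHistory _),
      countP_isInv_seqHistory] at this
    simpa [Event.isInv] using this

theorem cnt_le_countP_isInv (h : PartialLinearization T q₀ H N st blk start stat) (p : Fin n) :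
    cnt p (upTo blk N) ≤ H.countP (Event.isInv p) := by
  rw [h.countP_isInv]
  lia

theorem countP_isRes_le (h : PartialLinearization T q₀ H N st blk start stat) (p : Fin n) :
    H.countP (Event.isRes p) ≤ cnt p (upTo blk N) := by
  rw [← countP_isRes_subHistory]
  cases hp : stat p with
  | idle => rw [h.idle p hp, countP_isRes_subHistory, countP_isRes_seqHistory]
  | pending o =>
    rw [h.pending p o hp, List.countP_append, countP_isRes_subHistory, countP_isRes_seqHistory]
    simp [Event.isRes]
  | committed r =>
    have := congrArg (List.countP (Event.isRes p)) (h.committed p r hp)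
    rw [List.countP_append, countP_isRes_subHistory p (seqHistory _),
      countP_isRes_seqHistory] at this
    lia

theorem inv (h : PartialLinearization T q₀ H N st blk start stat) {p : Fin n}
    (hp : stat p = .idle) (o : T.O) :
    PartialLinearization T q₀ (H ++ [.inv p o]) N st blk (Function.update start p N)
      (Function.update stat p (.pending o)) where
  run_zero := h.run_zero
  run_succ := h.run_succ
  start_le q := by
    by_cases hq : q = p
    · simp [hq]
    · simpa [hq] using h.start_le q
  idle q hs := by
    by_cases hq : q = p
    · simp [hq] at hs
    · rw [Function.update_of_ne hq] at hs
      rw [subHistory_append, h.idle q hs]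
      simp [subHistory, Event.proc, Ne.symm hq]
  pending q o' hs := by
    by_cases hq : q = p
    · subst hq
      obtain rfl : o = o' := by simpa using hs
      rw [subHistory_append, h.idle q hp]
      simp [subHistory, Event.proc]
    · rw [Function.update_of_ne hq] at hs
      rw [subHistory_append, h.pending q o' hs]
      simp [subHistory, Event.proc, Ne.symm hq]
  committed q r hs := by
    by_cases hq : q = p
    · simp [hq] at hs
    · rw [Function.update_of_ne hq] at hs
      rw [subHistory_append, ← h.committed q r hs]
      simp [subHistory, Event.proc, Ne.symm hq]
  newer q o' hs j hj hj' := by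
    by_cases hq : q = p
    · subst hq
      simp only [Function.update_self] at hj
      lia
    · rw [Function.update_of_ne hq] at hs hj
      exact h.newer q o' hs j hj hj'
  before a b hab hb :=
    h.before a b (precedes_of_append hab (hb.trans_le (h.cnt_le_countP_isInv _))) hb
  older q o' hs a ha := by
    by_cases hq : q = p
    · subst hq
      have := lt_of_precedes ha
      rw [List.countP_append] at this
      simp only [Function.update_self]
      exact lt_of_lt_of_le (by simpa [Event.isRes] using this) (h.countP_isRes_le a.1)
    · rw [Function.update_of_ne hq] at hs ⊢
      refine h.older q o' hs a (precedes_of_append ha ?_)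
      simp [h.countP_isInv, hs]

theorem res (h : PartialLinearization T q₀ H N st blk start stat) {p : Fin n} {r : T.R}
    (hp : stat p = .committed r) :
    PartialLinearization T q₀ (H ++ [.res p r]) N st blk start
      (Function.update stat p .idle) where
  run_zero := h.run_zero
  run_succ := h.run_succ
  start_le := h.start_le
  idle q hs := by
    by_cases hq : q = p
    · subst hq
      rw [subHistory_append, ← h.committed q r hp]
      simp [subHistory, Event.proc]
    · rw [Function.update_of_ne hq] at hs
      rw [subHistory_append, h.idle q hs]
      simp [subHistory, Event.proc, Ne.symm hq]
  pending q o hs := by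
    by_cases hq : q = p
    · simp [hq] at hs
    · rw [Function.update_of_ne hq] at hs
      rw [subHistory_append, h.pending q o hs]
      simp [subHistory, Event.proc, Ne.symm hq]
  committed q r' hs := by
    by_cases hq : q = p
    · simp [hq] at hs
    · rw [Function.update_of_ne hq] at hs
      rw [subHistory_append, ← h.committed q r' hs]
      simp [subHistory, Event.proc, Ne.symm hq]
  newer q o hs := by
    by_cases hq : q = p
    · simp [hq] at hs
    · rw [Function.update_of_ne hq] at hs
      exact h.newer q o hs
  before a b hab hb :=
    h.before a b (precedes_of_append hab (hb.trans_le (h.cnt_le_countP_isInv _))) hb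
  older q o hs a ha := by
    by_cases hq : q = p
    · simp [hq] at hs
    · rw [Function.update_of_ne hq] at hs
      refine h.older q o hs a (precedes_of_append ha ?_)
      simp [h.countP_isInv, hs]

/-- Linearizing a pending operation: it is inserted into the sequence at a place that is not older
than its invocation. -/
theorem commit (h : PartialLinearization T q₀ H N st blk start stat) {p : Fin n} {o : T.O}
    (hp : stat p = .pending o) {r : T.R} {N' : ℕ} {st' : ℕ → T.Q}
    {blk' : ℕ → List (Fin n × T.O × T.R)} {j : ℕ} (hj : start p ≤ j)
    {Q : List (Fin n × T.O × T.R)} (hS : upTo blk N = upTo blk j ++ Q)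
    (hS' : upTo blk' N' = upTo blk j ++ (p, o, r) :: Q)
    (hQ : ∀ x ∈ Q, x.1 ≠ p) (hN : N ≤ N')
    (hmono : ∀ i ≤ N, ∀ q, cnt q (upTo blk i) ≤ cnt q (upTo blk' i))
    (hmem : ∀ i ≤ N', ∀ x ∈ blk' i, x.1 = p ∨ i ≤ N ∧ x ∈ blk i)
    (hrun₀ : T.Run q₀ (blk' 0) (st' 0))
    (hrun : ∀ j < N', T.Run (st' j) (blk' (j + 1)) (st' (j + 1))) :
    PartialLinearization T q₀ H N' st' blk' start
      (Function.update stat p (.committed r)) := by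
  have sub_ne : ∀ q, q ≠ p → subHistory (seqHistory (upTo blk' N')) q =
      subHistory (seqHistory (upTo blk N)) q := by
    intro q hq
    rw [hS, hS', seqHistory_append, seqHistory_append, seqHistory_cons, subHistory_append,
      subHistory_append]
    simp [subHistory, Event.proc, Ne.symm hq]
  have cnt_ne : ∀ q, q ≠ p → cnt q (upTo blk' N') = cnt q (upTo blk N) := by
    intro q hq
    rw [hS, hS', cnt_append, cnt_append, cnt_cons]
    simp [Ne.symm hq]
  have cnt_p : cnt p (upTo blk j) = cnt p (upTo blk N) := by
    rw [hS, cnt_append, cnt_eq_zero hQ, add_zero]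
  refine ⟨hrun₀, hrun, fun q => (h.start_le q).trans hN, fun q hs => ?_, fun q o' hs => ?_,
    fun q r' hs => ?_, fun q o' hs i hi hi' x hx => ?_, fun a b hab hb => ?_,
    fun q o' hs a ha => ?_⟩
  · by_cases hq : q = p
    · simp [hq] at hs
    · rw [Function.update_of_ne hq] at hs
      rw [sub_ne q hq, h.idle q hs]
  · by_cases hq : q = p
    · simp [hq] at hs
    · rw [Function.update_of_ne hq] at hs
      rw [sub_ne q hq, h.pending q o' hs]
  · by_cases hq : q = p
    · subst hq
      obtain rfl : r = r' := by simpa using hs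
      rw [h.pending q o hp, hS, hS', seqHistory_append, seqHistory_append, seqHistory_cons,
        subHistory_append, subHistory_append, subHistory_seqHistory_of_ne hQ,
        show ∀ (x y : Event n T.O T.R) l, x :: y :: l = [x, y] ++ l from fun _ _ _ => rfl,
        subHistory_append, subHistory_seqHistory_of_ne hQ]
      simp [subHistory, Event.proc]
    · rw [Function.update_of_ne hq] at hs
      rw [sub_ne q hq, h.committed q r' hs]
  · by_cases hq : q = p
    · simp [hq] at hs
    · rw [Function.update_of_ne hq] at hs
      rcases hmem i hi' x hx with hx | ⟨hi', hx⟩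
      · rw [hx]
        exact Ne.symm hq
      · exact h.newer q o' hs i hi hi' x hx
  · by_cases hb' : b.2 < cnt b.1 (upTo blk N)
    · have := h.before a b hab hb'
      rw [hS] at this hb'
      rw [hS']
      exact this.insert hb' hQ
    · -- `b` is the operation that has just been linearized
      have hbp : b.1 = p := by
        by_contra hne
        exact hb' (cnt_ne _ hne ▸ hb)
      have hb₂ : b.2 = cnt p (upTo blk N) := by
        rw [hbp] at hb hb'
        rw [hS', cnt_append, cnt_cons, cnt_eq_zero hQ, cnt_p] at hb
        simp only [↓reduceIte] at hb
        lia
      obtain ⟨b₁, b₂⟩ := b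
      obtain rfl : b₁ = p := hbp
      obtain rfl : b₂ = _ := hb₂
      refine ⟨upTo blk j, _, hS', ?_, cnt_p.le⟩
      exact (h.older _ o hp a hab).trans_le (cnt_upTo_mono _ _ hj)
  · by_cases hq : q = p
    · simp [hq] at hs
    · rw [Function.update_of_ne hq] at hs
      rw [cnt_ne q hq] at ha
      exact (h.older q o' hs a ha).trans_le (hmono _ (h.start_le q) _)

/-- A pending operation that can be performed in the state after block `j` without changing it may
be linearized there, even if the object has moved on in the meantime. -/
theorem commit_past (h : PartialLinearization T q₀ H N st blk start stat) {p : Fin n} {o : T.O}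
    (hp : stat p = .pending o) {r : T.R} {j : ℕ} (hj : start p ≤ j) (hjN : j ≤ N)
    (hΔ : T.Δ p (st j) o r (st j)) :
    PartialLinearization T q₀ H N st (Function.update blk j (blk j ++ [(p, o, r)])) start
      (Function.update stat p (.committed r)) := by
  obtain ⟨Q, hS, hS', hQ⟩ := upTo_split blk hjN (p, o, r)
  have hrun : ∀ q i, T.Run q (blk i) (st i) →
      T.Run q (Function.update blk j (blk j ++ [(p, o, r)]) i) (st i) := by
    intro q i hq
    by_cases hi : i = j
    · subst hi
      rw [Function.update_self]
      exact hq.append (.cons hΔ (.nil _))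
    · rwa [Function.update_of_ne hi]
  refine h.commit hp hj hS hS' (fun x hx => ?_) le_rfl (fun i hi q => ?_) (fun i hi x hx => ?_)
    (hrun _ _ h.run_zero) fun i hi => hrun _ _ (h.run_succ i hi)
  · obtain ⟨i, hi, hiN, hx⟩ := hQ x hx
    exact h.newer p o hp i (by lia) hiN x hx
  · by_cases hi' : j ≤ i
    · obtain ⟨Q', h₁, h₂, -⟩ := upTo_split blk hi' (p, o, r)
      rw [h₁, h₂, cnt_append, cnt_append, cnt_cons]
      lia
    · have : upTo (Function.update blk j (blk j ++ [(p, o, r)])) i = upTo blk i :=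
        upTo_congr fun k hk => Function.update_of_ne (by lia) _ _
      rw [this]
  · by_cases hij : i = j
    · subst hij
      simp only [Function.update_self, List.mem_append, List.mem_singleton] at hx
      rcases hx with hx | rfl
      · exact .inr ⟨hi, hx⟩
      · exact .inl rfl
    · rw [Function.update_of_ne hij] at hx
      exact .inr ⟨hi, hx⟩

/-- A pending operation may be linearized at the end, in a new block. -/
theorem commit_now (h : PartialLinearization T q₀ H N st blk start stat) {p : Fin n} {o : T.O}
    (hp : stat p = .pending o) {r : T.R} {q' : T.Q} (hΔ : T.Δ p (st N) o r q') :
    PartialLinearization T q₀ H (N + 1) (Function.update st (N + 1) q')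
      (Function.update blk (N + 1) [(p, o, r)]) start
      (Function.update stat p (.committed r)) := by
  have hupTo : ∀ i ≤ N, upTo (Function.update blk (N + 1) [(p, o, r)]) i = upTo blk i :=
    fun i hi => upTo_congr fun k hk => Function.update_of_ne (by lia) _ _
  refine h.commit hp (h.start_le p) (Q := []) (by simp) ?_ (by simp) (by lia)
    (fun i hi q => by rw [hupTo i hi]) (fun i hi x hx => ?_) ?_ fun i hi => ?_
  · rw [upTo_succ, hupTo N le_rfl, Function.update_self]
  · by_cases hiN : i = N + 1
    · subst hiN
      simp only [Function.update_self, List.mem_singleton] at hx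
      exact .inl (by rw [hx])
    · rw [Function.update_of_ne hiN] at hx
      exact .inr ⟨by lia, hx⟩
  · simpa using h.run_zero
  · rcases (Nat.lt_succ_iff_lt_or_eq.mp hi) with hi | rfl
    · simpa [Function.update, hi.ne, (hi.trans (Nat.lt_succ_self N)).ne] using h.run_succ i hi
    · simpa [Function.update] using ObjType.Run.cons hΔ (.nil _)

theorem run_upTo (h : PartialLinearization T q₀ H N st blk start stat) {j : ℕ} (hj : j ≤ N) :
    T.Run q₀ (upTo blk j) (st j) := by
  induction j with
  | zero => simpa [upTo] using h.run_zero
  | succ j ih =>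
    rw [upTo_succ]
    exact (ih (by lia)).append (h.run_succ j (by lia))

theorem linearizable_of_idle (h : PartialLinearization T q₀ H N st blk start stat)
    (hs : ∀ p, stat p = .idle) : Linearizable T q₀ H := by
  refine ⟨[], upTo blk N, (h.run_upTo le_rfl).legal, fun p => ?_, fun a b hab => ?_⟩
  · simpa using h.idle p (hs p)
  · rw [List.map_nil, List.append_nil] at hab
    have hb : b.2 < cnt b.1 (upTo blk N) := by
      simpa [h.countP_isInv, hs] using hab.1
    exact (h.before a b hab hb).precedes hb

theorem _root_.Linearizable.of_append_res {p : Fin n} {r : T.R}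
    (h : Linearizable T q₀ (H ++ [.res p r])) : Linearizable T q₀ H := by
  obtain ⟨C, S, hS⟩ := h
  exact ⟨(p, r) :: C, S, by simpa using hS⟩

/-- The operations that are not linearized yet can be linearized at the end, in any order. -/
theorem linearizable (h : PartialLinearization T q₀ H N st blk start stat) :
    Linearizable T q₀ H := by
  classical
  obtain ⟨s, hs⟩ : ∃ s : Finset (Fin n), ∀ p ∉ s, stat p = .idle := ⟨Finset.univ, by simp⟩
  induction s using Finset.induction_on generalizing H N st blk stat with
  | empty => exact h.linearizable_of_idle fun p => hs p (by simp)
  | insert p s _ ih =>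
    have of_committed : ∀ {N st blk stat r}, PartialLinearization T q₀ H N st blk start stat →
        (∀ q ∉ insert p s, stat q = .idle) → stat p = .committed r → Linearizable T q₀ H := by
      intro N st blk stat r h hs hp
      refine (ih (h.res hp) fun q hq => ?_).of_append_res
      by_cases hqp : q = p
      · simp [hqp]
      · rw [Function.update_of_ne hqp]
        exact hs q (by simp [hq, hqp])
    cases hp : stat p with
    | idle =>
      refine ih h fun q hq => ?_
      by_cases hqp : q = p
      · rw [hqp, hp]
      · exact hs q (by simp [hq, hqp])
    | committed r => exact of_committed h hs hp
    | pending o =>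
      obtain ⟨r, q', hΔ⟩ := T.total p (st N) o
      refine of_committed (h.commit_now hp hΔ) (fun q hq => ?_) (Function.update_self ..)
      have hqp : q ≠ p := fun hqp => hq (by simp [hqp])
      rw [Function.update_of_ne hqp]
      exact hs q hq

end PartialLinearization

/-! ### Wait-freedom from a decreasing rank -/

/-- An algorithm is wait-free if every answer to an access lowers a natural number that depends only
on the local state. -/
theorem Algorithm.waitFree_of_rank {n : ℕ} {B O R : Type u} {base : B → ObjType.{u} n}
    (A : Algorithm base O R) (rank : A.L → ℕ)
    (hrank : ∀ p l b o k x r y, A.next p l = .call b o k → (base b).Δ p x o r y →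
      rank (k r) < rank l) (ok : (ℕ → Label n O R) → Prop) : A.WaitFree ok := by
  intro c ℓ hexec _ p hp
  by_contra hres
  rw [Filter.not_frequently, Filter.eventually_atTop] at hres
  obtain ⟨t₀, hres⟩ := hres
  have hbusy : ∀ t, ℓ t = .access p → (c t).busy p = true := by
    intro t ht
    have hs := hexec.2 t
    generalize c (t + 1) = c' at hs
    rw [ht] at hs
    cases hs
    assumption
  have hstep : ∀ t ≥ t₀, (c t).busy p = true → (c (t + 1)).busy p = true ∧
      (ℓ t ≠ .access p → (c (t + 1)).loc p = (c t).loc p) ∧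
      (ℓ t = .access p → rank ((c (t + 1)).loc p) < rank ((c t).loc p)) := by
    intro t ht hb
    have hs := hexec.2 t
    have hr := hres t ht
    generalize c (t + 1) = c' at hs
    generalize ℓ t = l at hs hr
    cases hs with
    | inv q o hq =>
      have hqp : p ≠ q := by
        rintro rfl
        simp [hb] at hq
      simp [hqp, hb]
    | access q b o k r y hq hn hΔ =>
      by_cases hqp : p = q
      · subst hqp
        simpa [hb] using hrank _ _ _ _ _ _ _ _ hn hΔ
      · simp [hqp, hb, Ne.symm hqp]
    | res q r l hq hn =>
      have hqp : p ≠ q := by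
        rintro rfl
        exact hr ⟨r, rfl⟩
      simp [hqp, hb]
  have hmono : ∀ t ≥ t₀, (c t).busy p = true → ∀ s ≥ t,
      (c s).busy p = true ∧ rank ((c s).loc p) ≤ rank ((c t).loc p) := by
    intro t ht hb s hs
    induction s, hs using Nat.le_induction with
    | base => exact ⟨hb, le_rfl⟩
    | succ s hs ih =>
      obtain ⟨h₁, h₂, h₃⟩ := hstep s (ht.trans hs) ih.1
      refine ⟨h₁, ?_⟩
      by_cases hl : ℓ s = .access p
      · exact (h₃ hl).le.trans ih.2
      · rw [h₂ hl]
        exact ih.2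
  rw [Filter.frequently_atTop] at hp
  have key : ∀ m t, t₀ ≤ t → (c t).busy p = true → rank ((c t).loc p) ≠ m := by
    intro m
    induction m using Nat.strong_induction_on with
    | _ m ih =>
      rintro t ht hb rfl
      obtain ⟨s, hs, hl⟩ := hp t
      obtain ⟨hb', hle⟩ := hmono t ht hb s hs
      obtain ⟨h₁, -, h₃⟩ := hstep s (ht.trans hs) hb'
      exact ih _ ((h₃ hl).trans_le hle) (s + 1) (ht.trans (hs.trans s.le_succ)) h₁ rfl
  obtain ⟨s, hs, hl⟩ := hp t₀
  exact key _ s hs (hbusy s hl) rfl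

/-! ### Objects that store a growing set -/

/-- A description of the type `T` as a growing set: `enc` turns sets into states, and an operation
of `p` that finds the set `V` is decided by `dec`.  Either it gives the answer `r` and changes
nothing, or it gives the answer `r` and inserts `e`, and then it may do the same in every larger
set. -/
structure GrowingSet {n : ℕ} (T : ObjType.{u} n) (X : Type u) where
  enc : Set X → T.Q
  dec : Fin n → T.O → Set X → T.R × Option X
  query : ∀ {p o V r}, dec p o V = (r, none) → T.Δ p (enc V) o r (enc V)
  insert : ∀ {p o V V' r e}, dec p o V = (r, some e) → V ⊆ V' →
    T.Δ p (enc V') o r (enc (Insert.insert e V'))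

namespace GrowingSet

/-- The content of the register of a process: the elements that it has inserted, and the snapshot
of all registers on which its last insertion was based. -/
structure Cell (X : Type u) : Type u where
  data : Set X
  view : Set X

/-- What a process is doing.  While it scans for the operation `o`, it stores the data `m i` that it
has last seen in the register of `i` (`∅` at first), the number `ch i` of changes that it has seen
there, and the register `pos` to be read next; the registers before `pos` have been read without
any change since the last change that was seen. -/
inductive Phase (n : ℕ) (O R X : Type u) : Type u
  | scan (o : O) (m : Fin n → Set X) (ch : Fin n → ℕ) (pos : Fin n) : Phase n O R X
  | write (V : Set X) (e : X) (r : R) : Phase n O R X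
  | reply (r : R) : Phase n O R X

/-- The local state of a process: the data of its own register, and its phase. -/
structure Local (n : ℕ) (O R X : Type u) : Type u where
  own : Set X
  phase : Phase n O R X

variable {n : ℕ} {T : ObjType.{u} n} {X : Type u}

/-- How `p` goes on with the operation `o` when the snapshot `V` has been taken. -/
def finish (D : GrowingSet T X) (p : Fin n) (o : T.O) (V : Set X) : Phase n T.O T.R X :=
  match D.dec p o V with
  | (r, none) => .reply r
  | (r, some e) => .write V e r

open Classical in
/-- How `p` goes on with its scan when it has found `w` in the register `pos`.  It stops when all
registers in turn have been found unchanged, or at the third change of the same register. -/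
noncomputable def afterRead (D : GrowingSet T X) (p : Fin n) (o : T.O) (m : Fin n → Set X)
    (ch : Fin n → ℕ) (pos : Fin n) (w : Cell X) : Phase n T.O T.R X :=
  if w.data = m pos then
    if h : pos.val + 1 < n then .scan o m ch ⟨pos + 1, h⟩ else D.finish p o (⋃ i, m i)
  else if 2 ≤ ch pos then D.finish p o w.view
  else .scan o (Function.update m pos w.data) (Function.update ch pos (ch pos + 1)) ⟨0, p.pos⟩

/-- The next action of `p`.  Reads never return an acknowledgement, so the second case of the
continuation of a read does not matter. -/
noncomputable def next (D : GrowingSet T X) (p : Fin n) (l : Local n T.O T.R X) :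
    LocalStep (fun _ : ULift.{u} (Fin n) => register n (Cell X)) T.R (Local n T.O T.R X) :=
  match l.phase with
  | .scan o m ch pos => .call ⟨pos⟩ RegOp.read fun
    | .val w => ⟨l.own, D.afterRead p o m ch pos w⟩
    | .ack => l
  | .write V e r => .call ⟨p⟩ (RegOp.write ⟨Insert.insert e l.own, V⟩) fun _ =>
      ⟨Insert.insert e l.own, .reply r⟩
  | .reply r => .ret r l

/-- The implementation with one register per process.  The answer `r₀` only fills the unused phase
of the initial local states. -/
noncomputable def algorithm (D : GrowingSet T X) (r₀ : T.R) :
    Algorithm (fun _ : ULift.{u} (Fin n) => register n (Cell X)) T.O T.R where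
  objInit _ := (⟨∅, ∅⟩ : Cell X)
  objInit_mem _ := Set.mem_univ _
  L := Local n T.O T.R X
  localInit _ := ⟨∅, .reply r₀⟩
  start p l o := ⟨l.own, .scan o (fun _ => ∅) (fun _ => 0) ⟨0, p.pos⟩⟩
  next := D.next

/-- An upper bound for the number of accesses that remain in the current operation. -/
def rank : Phase n T.O T.R X → ℕ
  | .scan _ _ ch pos => 2 + ((∑ i, (2 - ch i)) * n + (n - pos))
  | .write _ _ _ => 1
  | .reply _ => 0

theorem rank_finish_le (D : GrowingSet T X) (p : Fin n) (o : T.O) (V : Set X) :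
    rank (D.finish p o V) ≤ 1 := by
  unfold finish
  split <;> simp [rank]

theorem rank_afterRead_lt (D : GrowingSet T X) (p : Fin n) (o : T.O) (m : Fin n → Set X)
    (ch : Fin n → ℕ) (pos : Fin n) (w : Cell X) :
    rank (D.afterRead p o m ch pos w) < rank (.scan o m ch pos : Phase n T.O T.R X) := by
  have hfin : ∀ V, rank (D.finish p o V) < rank (.scan o m ch pos : Phase n T.O T.R X) := by
    intro V
    refine (D.rank_finish_le p o V).trans_lt ?_
    simp only [rank]
    lia
  unfold afterRead
  split_ifs with h₁ h₂ h₃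
  · simp only [rank]
    lia
  · exact hfin _
  · exact hfin _
  · have hsum : ∑ i, (2 - Function.update ch pos (ch pos + 1) i) + 1 ≤ ∑ i, (2 - ch i) := by
      refine Nat.succ_le_of_lt (Finset.sum_lt_sum (fun i _ => ?_) ⟨pos, Finset.mem_univ _, ?_⟩)
      · by_cases hi : i = pos
        · subst hi
          simp only [Function.update_self]
          lia
        · rw [Function.update_of_ne hi]
      · simp only [Function.update_self]
        lia
    have := Nat.mul_le_mul_right n hsum
    have := pos.isLt
    simp only [rank]
    lia

theorem waitFree (D : GrowingSet T X) (r₀ : T.R) (ok : (ℕ → Label n T.O T.R) → Prop) :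
    (D.algorithm r₀).WaitFree ok := by
  refine Algorithm.waitFree_of_rank _ (fun l : Local n T.O T.R X => rank l.phase) ?_ ok
  rintro p ⟨own, phase⟩ b o k x r y hn hΔ
  cases phase with
  | scan o' m ch pos =>
    cases hn
    cases hΔ
    exact D.rank_afterRead_lt p o' m ch pos x
  | write V e r =>
    cases hn
    cases hΔ
    simp [rank]
  | reply r => cases hn

end GrowingSet

/-! ### Correctness of the snapshot algorithm -/

/-- Auxiliary information about an execution: a linearization under construction, and for each of
its blocks `j` the data `arr j i` that the register of each process `i` contained. -/
structure Ghost {n : ℕ} (T : ObjType.{u} n) (X : Type u) where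
  N : ℕ
  st : ℕ → T.Q
  blk : ℕ → List (Fin n × T.O × T.R)
  start : Fin n → ℕ
  stat : Fin n → Status T.O T.R
  arr : ℕ → Fin n → Set X

namespace GrowingSet

variable {n : ℕ} {T : ObjType.{u} n} {X : Type u}

/-- `V` was the content of the object at some moment since `p` invoked its operation. -/
def Snapshot (G : Ghost T X) (p : Fin n) (V : Set X) : Prop :=
  ∃ j, G.start p ≤ j ∧ j ≤ G.N ∧ V = ⋃ i, G.arr j i

/-- What `p` may conclude from `k` changes of the register of `i` since its invocation: after one
change, the current operation of `i` started later than that of `p`; after two changes, moreover,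
the view in the register of `i` is good enough for `p`. -/
def Level (G : Ghost T X) (cells : Fin n → Cell X) (p i : Fin n) (k : ℕ) : Prop :=
  (1 ≤ k → ∀ o, G.stat i = .pending o → G.start p ≤ G.start i) ∧
  (2 ≤ k → Snapshot G p (cells i).view)

/-- The invariant of a process `p` that is executing an operation.  In a scan, `m` agrees
with the data at some block `j` for the registers before `pos`.  The first change seen in a register
may have been made before the invocation, hence `ch i - 1`; if the register of `i` has changed again
since it was last read, this is one more change. -/
def PhaseInv (D : GrowingSet T X) (G : Ghost T X) (cells : Fin n → Cell X) (p : Fin n) :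
    Phase n T.O T.R X → Prop
  | .scan o m ch pos => G.stat p = .pending o ∧
      (∃ j, G.start p ≤ j ∧ j ≤ G.N ∧ (∀ i, m i ⊆ G.arr j i) ∧ ∀ i < pos, m i = G.arr j i) ∧
      ∀ i, Level G cells p i (ch i - 1) ∧ ((cells i).data ≠ m i → Level G cells p i (ch i))
  | .write V e r => ∃ o, G.stat p = .pending o ∧ D.dec p o V = (r, some e) ∧ Snapshot G p V
  | .reply r => G.stat p = .committed r

/-- The invariant of the algorithm: block `j` of the linearization leaves the object with the union
of the data `arr j i`, these data grow with `j`, and the last ones are those in the registers. -/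
structure Inv (D : GrowingSet T X) (H : List (Event n T.O T.R)) (G : Ghost T X)
    (cells : Fin n → Cell X) (loc : Fin n → Local n T.O T.R X) (busy : Fin n → Bool) : Prop where
  lin : PartialLinearization T (D.enc ∅) H G.N G.st G.blk G.start G.stat
  st_eq : ∀ j ≤ G.N, G.st j = D.enc (⋃ i, G.arr j i)
  mono : ∀ j k, j ≤ k → k ≤ G.N → ∀ i, G.arr j i ⊆ G.arr k i
  data : ∀ i, (cells i).data = G.arr G.N i
  own : ∀ i, (loc i).own = G.arr G.N i
  idle : ∀ p, busy p = false → G.stat p = .idle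
  phase : ∀ p, busy p = true → D.PhaseInv G cells p (loc p).phase

variable {D : GrowingSet T X} {H : List (Event n T.O T.R)} {G G' : Ghost T X}
  {cells cells' : Fin n → Cell X} {loc : Fin n → Local n T.O T.R X} {busy : Fin n → Bool}
  {p q i : Fin n}

theorem Level.zero : Level G cells p i 0 := ⟨by simp, by simp⟩

theorem Snapshot.mono {V : Set X} (h : Snapshot G p V) (hN : G.N ≤ G'.N)
    (harr : ∀ j ≤ G.N, G'.arr j = G.arr j) (hstart : G'.start p = G.start p) :
    Snapshot G' p V := by
  obtain ⟨j, h₁, h₂, rfl⟩ := h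
  exact ⟨j, hstart ▸ h₁, h₂.trans hN, by rw [harr j h₂]⟩

/-- Steps of other processes preserve the invariant of a process, provided that they raise the
level of a register whenever they change its data. -/
theorem PhaseInv.frame {φ : Phase n T.O T.R X} (h : D.PhaseInv G cells q φ) (hN : G.N ≤ G'.N)
    (harr : ∀ j ≤ G.N, G'.arr j = G.arr j) (hstart : G'.start q = G.start q)
    (hstat : G'.stat q = G.stat q)
    (hlevel : ∀ i k, Level G cells q i k → Level G' cells' q i k ∧
      ((cells' i).data ≠ (cells i).data → Level G' cells' q i (k + 1))) :
    D.PhaseInv G' cells' q φ := by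
  cases φ with
  | scan o m ch pos =>
    obtain ⟨hp, ⟨j, hj, hjN, hm, hm'⟩, hl⟩ := h
    refine ⟨hstat.trans hp, ⟨j, hstart ▸ hj, hjN.trans hN, ?_, ?_⟩, fun i => ⟨?_, fun hd => ?_⟩⟩
    · simpa only [harr j hjN] using hm
    · simpa only [harr j hjN] using hm'
    · exact (hlevel i _ (hl i).1).1
    · by_cases hc : (cells' i).data = (cells i).data
      · exact (hlevel i _ ((hl i).2 (hc ▸ hd))).1
      · have := (hlevel i _ (hl i).1).2 hc
        rcases Nat.eq_zero_or_pos (ch i) with h₀ | h₀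
        · rw [h₀]
          exact .zero
        · rwa [Nat.sub_add_cancel h₀] at this
  | write V e r =>
    obtain ⟨o, hp, hdec, hV⟩ := h
    exact ⟨o, hstat.trans hp, hdec, hV.mono hN harr hstart⟩
  | reply r => exact hstat.trans h

theorem Level.mono {k : ℕ} (h : Level G cells q i k) (hN : G.N ≤ G'.N)
    (harr : ∀ j ≤ G.N, G'.arr j = G.arr j) (hstart : G'.start q = G.start q)
    (hview : (cells' i).view = (cells i).view)
    (hstat : ∀ o, G'.stat i = .pending o → (∀ o, G.stat i = .pending o → G.start q ≤ G.start i) →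
      G.start q ≤ G'.start i) : Level G' cells' q i k := by
  refine ⟨fun hk o ho => ?_, fun hk => ?_⟩
  · rw [hstart]
    exact hstat o ho (h.1 hk)
  · rw [hview]
    exact (h.2 hk).mono hN harr hstart

theorem Inv.initial (D : GrowingSet T X) (r₀ : T.R) :
    D.Inv [] ⟨0, fun _ => D.enc ∅, fun _ => [], fun _ => 0, fun _ => .idle, fun _ _ => ∅⟩
      (fun _ => ⟨∅, ∅⟩) (fun _ => ⟨∅, .reply r₀⟩) (fun _ => false) where
  lin := .initial T _
  st_eq := by simp
  mono := by simp
  data := by simp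
  own := by simp
  idle := by simp
  phase := by simp

theorem Inv.invoke (h : D.Inv H G cells loc busy) (hb : busy p = false) (o : T.O) :
    ∃ G', D.Inv (H ++ [.inv p o]) G' cells
      (Function.update loc p ⟨(loc p).own, .scan o (fun _ => ∅) (fun _ => 0) ⟨0, p.pos⟩⟩)
      (Function.update busy p true) := by
  refine ⟨{ G with
    start := Function.update G.start p G.N
    stat := Function.update G.stat p (.pending o) }, h.lin.inv (h.idle p hb) o, h.st_eq, h.mono,
    h.data, fun i => ?_, fun q hq => ?_, fun q hq => ?_⟩
  · by_cases hi : i = p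
    · subst hi
      simpa using h.own i
    · simpa [hi] using h.own i
  · by_cases hqp : q = p
    · simp [hqp] at hq
    · rw [Function.update_of_ne hqp] at hq
      simpa [hqp] using h.idle q hq
  · by_cases hqp : q = p
    · subst hqp
      rw [Function.update_self]
      refine ⟨by simp, ⟨G.N, by simp, le_rfl, by simp, fun i hi => ?_⟩,
        fun i => ⟨.zero, fun _ => .zero⟩⟩
      exact absurd hi (Nat.not_lt_zero _)
    · rw [Function.update_of_ne hqp] at hq ⊢
      refine (h.phase q hq).frame le_rfl (fun _ _ => rfl) (by simp [hqp]) (by simp [hqp])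
        fun i k hl => ⟨hl.mono le_rfl (fun _ _ => rfl) (by simp [hqp]) rfl fun o' ho hold => ?_,
          fun hne => absurd rfl hne⟩
      by_cases hip : i = p
      · subst hip
        simpa using h.lin.start_le q
      · simp only [Function.update_of_ne hip] at ho ⊢
        exact hold o' ho

theorem Inv.respond (h : D.Inv H G cells loc busy) (hb : busy p = true) {r : T.R}
    (hp : (loc p).phase = .reply r) :
    ∃ G', D.Inv (H ++ [.res p r]) G' cells loc (Function.update busy p false) := by
  have hs : G.stat p = .committed r := by
    have := h.phase p hb
    rwa [hp] at this
  refine ⟨{ G with stat := Function.update G.stat p .idle }, h.lin.res hs, h.st_eq, h.mono,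
    h.data, h.own, fun q hq => ?_, fun q hq => ?_⟩
  · by_cases hqp : q = p
    · simp [hqp]
    · rw [Function.update_of_ne hqp] at hq
      simpa [hqp] using h.idle q hq
  · by_cases hqp : q = p
    · simp [hqp] at hq
    · rw [Function.update_of_ne hqp] at hq
      refine (h.phase q hq).frame le_rfl (fun _ _ => rfl) rfl (by simp [hqp])
        fun i k hl => ⟨hl.mono le_rfl (fun _ _ => rfl) rfl rfl fun o' ho hold => ?_,
          fun hne => absurd rfl hne⟩
      by_cases hip : i = p
      · simp [hip] at ho
      · simp only [Function.update_of_ne hip] at ho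
        exact hold o' ho

theorem Inv.set_phase (h : D.Inv H G cells loc busy) {φ : Phase n T.O T.R X}
    (hφ : busy p = true → D.PhaseInv G cells p φ) :
    D.Inv H G cells (Function.update loc p ⟨(loc p).own, φ⟩) busy := by
  refine ⟨h.lin, h.st_eq, h.mono, h.data, fun i => ?_, h.idle, fun q hq => ?_⟩
  · by_cases hi : i = p
    · subst hi
      simpa using h.own i
    · simpa [hi] using h.own i
  · by_cases hqp : q = p
    · subst hqp
      simpa using hφ hq
    · simpa [hqp] using h.phase q hq

/-- With a snapshot, a process can decide its operation; if nothing is to be inserted, the operation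
is linearized at the moment of the snapshot. -/
theorem Inv.finish (h : D.Inv H G cells loc busy) (hb : busy p = true) {o : T.O}
    (hp : G.stat p = .pending o) {V : Set X} (hV : Snapshot G p V) :
    ∃ G', D.Inv H G' cells (Function.update loc p ⟨(loc p).own, D.finish p o V⟩) busy := by
  rcases hdec : D.dec p o V with ⟨r, _ | e⟩
  · obtain ⟨j, hj, hjN, rfl⟩ := hV
    have hΔ : T.Δ p (G.st j) o r (G.st j) := by
      rw [h.st_eq j hjN]
      exact D.query hdec
    have h' : D.Inv H { G with
        blk := Function.update G.blk j (G.blk j ++ [(p, o, r)])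
        stat := Function.update G.stat p (.committed r) } cells
        (Function.update loc p ⟨(loc p).own, .reply r⟩) busy := by
      refine ⟨h.lin.commit_past hp hj hjN hΔ, h.st_eq, h.mono, h.data, fun i => ?_, fun q hq => ?_,
        fun q hq => ?_⟩
      · by_cases hi : i = p
        · subst hi
          simpa using h.own i
        · simpa [hi] using h.own i
      · have hqp : q ≠ p := by
          rintro rfl
          simp [hb] at hq
        simpa [hqp] using h.idle q hq
      · by_cases hqp : q = p
        · subst hqp
          simp [PhaseInv]
        · rw [Function.update_of_ne hqp]
          refine (h.phase q hq).frame le_rfl (fun _ _ => rfl) rfl (by simp [hqp])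
            fun i k hl => ⟨hl.mono le_rfl (fun _ _ => rfl) rfl rfl fun o' ho hold => ?_,
              fun hne => absurd rfl hne⟩
          by_cases hip : i = p
          · simp [hip] at ho
          · simp only [Function.update_of_ne hip] at ho
            exact hold o' ho
    rw [GrowingSet.finish, hdec]
    exact ⟨_, h'⟩
  · refine ⟨G, h.set_phase fun _ => ?_⟩
    rw [GrowingSet.finish, hdec]
    exact ⟨o, hp, hdec, hV⟩

theorem Inv.read (h : D.Inv H G cells loc busy) (hb : busy p = true) {o : T.O}
    {m : Fin n → Set X} {ch : Fin n → ℕ} {pos : Fin n}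
    (hp : (loc p).phase = .scan o m ch pos) :
    ∃ G', D.Inv H G' cells
      (Function.update loc p ⟨(loc p).own, D.afterRead p o m ch pos (cells pos)⟩) busy := by
  have hφ := h.phase p hb
  rw [hp] at hφ
  obtain ⟨hs, ⟨j, hj, hjN, hm, hm'⟩, hl⟩ := hφ
  unfold afterRead
  split_ifs with h₁ h₂ h₃
  -- The register `pos` has not changed since it was last read, so it had the same data at the
  -- moment `j` in between.
  all_goals try
    have hpos : ∀ i : Fin n, i.val < pos + 1 → m i = G.arr j i := by
      intro i hi
      rcases Nat.lt_succ_iff_lt_or_eq.mp hi with hi | hi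
      · exact hm' i hi
      · obtain rfl := Fin.ext hi
        refine (hm i).antisymm ?_
        rw [← h₁, h.data]
        exact h.mono j _ hjN le_rfl i
  · exact ⟨G, h.set_phase fun _ => ⟨hs, ⟨j, hj, hjN, hm, hpos⟩, hl⟩⟩
  · refine h.finish hb hs ⟨j, hj, hjN, Set.iUnion_congr fun i => hpos i ?_⟩
    have := i.isLt
    have := pos.isLt
    lia
  · exact h.finish hb hs (((hl pos).2 h₁).2 h₃)
  · refine ⟨G, h.set_phase fun _ => ⟨hs, ⟨G.N, h.lin.start_le p, le_rfl, fun i => ?_, ?_⟩,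
      fun i => ?_⟩⟩
    · by_cases hi : i = pos
      · subst hi
        simp [h.data]
      · rw [Function.update_of_ne hi]
        exact (hm i).trans (h.mono j _ hjN le_rfl i)
    · exact fun i hi => absurd hi (Nat.not_lt_zero _)
    · by_cases hi : i = pos
      · subst hi
        simpa using (hl i).2 h₁
      · simpa [hi] using hl i

theorem Inv.write (h : D.Inv H G cells loc busy) (hb : busy p = true) {V : Set X} {e : X}
    {r : T.R} (hp : (loc p).phase = .write V e r) :
    ∃ G', D.Inv H G' (Function.update cells p ⟨Insert.insert e (loc p).own, V⟩)
      (Function.update loc p ⟨Insert.insert e (loc p).own, .reply r⟩) busy := by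
  have hφ := h.phase p hb
  rw [hp] at hφ
  obtain ⟨o, hs, hdec, j, hj, hjN, rfl⟩ := hφ
  have hΔ : T.Δ p (G.st G.N) o r (D.enc (Insert.insert e (⋃ i, G.arr G.N i))) := by
    rw [h.st_eq _ le_rfl]
    exact D.insert hdec (Set.iUnion_mono fun i => h.mono j _ hjN le_rfl i)
  set A := Function.update (G.arr G.N) p (Insert.insert e (loc p).own) with hA
  have hsub : ∀ i, G.arr G.N i ⊆ A i := by
    intro i
    by_cases hi : i = p
    · subst hi
      rw [hA, Function.update_self, h.own]
      exact Set.subset_insert _ _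
    · rw [hA, Function.update_of_ne hi]
  have hunion : (⋃ i, A i) = Insert.insert e (⋃ i, G.arr G.N i) := by
    ext x
    simp only [Set.mem_iUnion, Set.mem_insert_iff]
    constructor
    · rintro ⟨i, hi⟩
      by_cases hip : i = p
      · subst hip
        rw [hA, Function.update_self, h.own] at hi
        exact hi.imp_right fun hx => ⟨i, hx⟩
      · rw [hA, Function.update_of_ne hip] at hi
        exact .inr ⟨i, hi⟩
    · rintro (rfl | ⟨i, hi⟩)
      · exact ⟨p, by simp [hA]⟩
      · exact ⟨i, hsub i hi⟩
  have harr : ∀ k ≤ G.N, Function.update G.arr (G.N + 1) A k = G.arr k :=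
    fun k hk => Function.update_of_ne (by lia) _ _
  refine ⟨⟨G.N + 1, Function.update G.st (G.N + 1) (D.enc (Insert.insert e (⋃ i, G.arr G.N i))),
    Function.update G.blk (G.N + 1) [(p, o, r)], G.start,
    Function.update G.stat p (.committed r), Function.update G.arr (G.N + 1) A⟩,
    h.lin.commit_now hs hΔ, fun k hk => ?_, fun k l hkl hl i => ?_, fun i => ?_, fun i => ?_,
    fun q hq => ?_, fun q hq => ?_⟩
  · dsimp only at hk ⊢
    rcases Nat.le_succ_iff.mp hk with hk | rfl
    · rw [harr k hk, Function.update_of_ne (by lia), h.st_eq k hk]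
    · simp [hunion]
  · dsimp only at hl ⊢
    rcases Nat.le_succ_iff.mp hl with hl | rfl
    · rw [harr l hl, harr k (hkl.trans hl)]
      exact h.mono k l hkl hl i
    · rcases Nat.le_succ_iff.mp hkl with hk | rfl
      · rw [harr k hk, Function.update_self]
        exact (h.mono k _ hk le_rfl i).trans (hsub i)
      · rfl
  · by_cases hi : i = p
    · subst hi
      simp [hA]
    · simp [hA, hi, h.data]
  · by_cases hi : i = p
    · subst hi
      simp [hA]
    · simp [hA, hi, h.own]
  · have hqp : q ≠ p := by
      rintro rfl
      simp [hb] at hq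
    simpa [hqp] using h.idle q hq
  · by_cases hqp : q = p
    · subst hqp
      simp [PhaseInv]
    · rw [Function.update_of_ne hqp]
      refine (h.phase q hq).frame (by simp) harr rfl (by simp [hqp]) fun i k hl => ?_
      by_cases hip : i = p
      · subst hip
        -- The view was taken during the operation that ends with this write; if this operation
        -- started later than that of `q`, then `q` may use the view.
        have hview : 1 ≤ k → Snapshot G q (⋃ i, G.arr j i) := fun hk =>
          ⟨j, (hl.1 hk o hs).trans hj, hjN, rfl⟩
        refine ⟨⟨by simp, fun hk => ?_⟩, fun _ => ⟨by simp, fun hk => ?_⟩⟩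
        all_goals
          rw [Function.update_self]
          exact (hview (by lia)).mono (Nat.le_succ _) harr rfl
      · refine ⟨hl.mono (by simp) harr rfl (by simp [hip]) fun o' ho hold => ?_, ?_⟩
        · simp only [Function.update_of_ne hip] at ho
          exact hold o' ho
        · simp [hip]

theorem Inv.congr {H' : List (Event n T.O T.R)} {loc' : Fin n → Local n T.O T.R X}
    (h : D.Inv H G cells loc busy) (hH : H' = H) (hcells : ∀ i, cells' i = cells i)
    (hloc : ∀ i, loc' i = loc i) : D.Inv H' G cells' loc' busy := by
  obtain rfl := funext hcells
  obtain rfl := funext hloc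
  rwa [hH]

theorem update_ulift_up [DecidableEq (ULift.{u} (Fin n))] {Y : Type*}
    (f : ULift.{u} (Fin n) → Y) (p i : Fin n) (y : Y) :
    Function.update f ⟨p⟩ y ⟨i⟩ = Function.update (fun i => f ⟨i⟩) p y i := by
  by_cases hi : i = p
  · subst hi
    simp
  · simp [hi]

theorem exists_inv (D : GrowingSet T X) (r₀ : T.R) {c : (D.algorithm r₀).Config}
    {H : List (Event n T.O T.R)} (h : (D.algorithm r₀).Reaches c H) :
    ∃ G, D.Inv H G (fun i => c.obj ⟨i⟩) c.loc c.busy := by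
  induction h with
  | initial => exact ⟨_, .initial D r₀⟩
  | @step c₀ _ _ _ _ hs ih =>
    obtain ⟨G, hG⟩ := ih
    cases hs with
    | inv p o hb => exact hG.invoke hb o
    | access p b o k r y hb hn hΔ =>
      rcases hp : c₀.loc p with ⟨own, φ⟩
      change D.next p (c₀.loc p) = _ at hn
      rw [hp] at hn
      have hφ : (c₀.loc p).phase = φ := by rw [hp]
      have hown : (c₀.loc p).own = own := by rw [hp]
      cases φ with
      | scan o' m ch pos =>
        cases hn
        cases hΔ
        obtain ⟨G', hG'⟩ := hG.read hb hφ
        rw [hown] at hG'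
        exact ⟨G', hG'.congr (List.append_nil _)
          (fun i => congrFun (@Function.update_eq_self _ _ (Classical.decEq _) ⟨pos⟩ c₀.obj) ⟨i⟩)
          fun _ => rfl⟩
      | write V e r' =>
        cases hn
        cases hΔ
        obtain ⟨G', hG'⟩ := hG.write hb hφ
        rw [hown] at hG'
        exact ⟨G', hG'.congr (List.append_nil _)
          (fun i => @update_ulift_up n (Classical.decEq _) (Cell X) c₀.obj p i _) fun _ => rfl⟩
      | reply r' => cases hn
    | res p r l hb hn =>
      rcases hp : c₀.loc p with ⟨own, φ⟩
      change D.next p (c₀.loc p) = _ at hn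
      rw [hp] at hn
      have hφ : (c₀.loc p).phase = φ := by rw [hp]
      cases φ with
      | scan o' m ch pos => cases hn
      | write V e r' => cases hn
      | reply r' =>
        cases hn
        obtain ⟨G', hG'⟩ := hG.respond hb hφ
        refine ⟨G', ?_⟩
        rw [← hp, Function.update_eq_self]
        exact hG'

theorem waitFreeImplements (D : GrowingSet T X) (r₀ : T.R) (hT : T.Q₀ = {D.enc ∅}) :
    WaitFreeImplements (fun _ : ULift.{u} (Fin n) => register n (Cell X)) T := by
  intro q₀ hq₀
  obtain rfl : q₀ = D.enc ∅ := by rwa [hT] at hq₀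
  refine ⟨D.algorithm r₀, D.waitFree r₀ _, fun c H h => ?_⟩
  obtain ⟨G, hG⟩ := D.exists_inv r₀ h
  exact hG.lin.linearizable

end GrowingSet

/-! ### The AllowList object as a growing set -/

open Classical in
/-- The AllowList object stores the set of listed values and issued proofs. -/
noncomputable def allowListGrowingSet {n : ℕ} (par : AllowListParams.{u} n) :
    GrowingSet (allowList par) (par.U ⊕ (Fin n × Set par.U × par.Prf)) where
  enc V := (⟨Sum.inl ⁻¹' V, Sum.inr ⁻¹' V⟩ : par.State)
  dec p o V := match (o : par.Op) with
    | .append y =>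
      if p ∈ par.managers ∧ y ∈ par.S then (AllowListParams.Res.true, some (.inl y))
      else (AllowListParams.Res.false, none)
    | .prove y =>
      if h : ∃ x : Set par.U × par.Prf, p ∈ par.verifiers ∧ y ∈ par.lang x.1 ∧
          x.1 ⊆ Sum.inl ⁻¹' V ∧ x.2 ∈ par.validProofs x.1 y then
        (AllowListParams.Res.proof h.choose.1 h.choose.2, some (.inr (p, h.choose)))
      else (AllowListParams.Res.false, none)
    | .read => (AllowListParams.Res.proofs (Sum.inr ⁻¹' V), none)
  query := by
    intro p o V r h
    cases o with
    | append y =>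
      dsimp only at h
      split_ifs at h with hy
      · cases (Prod.mk.inj h).2
      obtain rfl := (Prod.mk.inj h).1
      exact .appendInvalid _ _ _ (not_and_or.mp hy)
    | prove y =>
      dsimp only at h
      split_ifs at h with hy
      · cases (Prod.mk.inj h).2
      obtain rfl := (Prod.mk.inj h).1
      refine .proveInvalid _ _ _ fun A P => ?_
      by_contra hAP
      push Not at hAP
      exact hy ⟨(A, P), hAP.2.2.2, hAP.1, hAP.2.1, hAP.2.2.1⟩
    | read =>
      obtain rfl := (Prod.mk.inj h).1
      exact .read _ _
  insert := by
    intro p o V V' r e h hV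
    cases o with
    | append y =>
      dsimp only at h
      split_ifs at h with hy
      case neg => cases (Prod.mk.inj h).2
      obtain ⟨rfl, he⟩ := Prod.mk.inj h
      obtain rfl := Option.some.inj he
      have h₁ : Sum.inl ⁻¹' (Insert.insert (.inl y) V') =
          Sum.inl ⁻¹' V' ∪ ({y} : Set par.U) := by
        ext x
        simp
      have h₂ : Sum.inr ⁻¹' (Insert.insert (.inl y) V') =
          (Sum.inr ⁻¹' V' : Set (Fin n × Set par.U × par.Prf)) := by
        ext x
        simp
      rw [h₁, h₂]
      exact .appendValid p ⟨Sum.inl ⁻¹' V', Sum.inr ⁻¹' V'⟩ y hy.1 hy.2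
    | prove y =>
      dsimp only at h
      split_ifs at h with hy
      case neg => cases (Prod.mk.inj h).2
      obtain ⟨rfl, he⟩ := Prod.mk.inj h
      obtain rfl := Option.some.inj he
      obtain ⟨hp, hlang, hA, hP⟩ := hy.choose_spec
      have h₁ : Sum.inl ⁻¹' (Insert.insert (.inr (p, hy.choose)) V') =
          (Sum.inl ⁻¹' V' : Set par.U) := by
        ext x
        simp
      have h₂ : Sum.inr ⁻¹' (Insert.insert (.inr (p, hy.choose)) V') =
          Sum.inr ⁻¹' V' ∪ ({(p, hy.choose)} : Set (Fin n × Set par.U × par.Prf)) := by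
        ext x
        simp [or_comm]
      rw [h₁, h₂]
      exact .proveValid p ⟨Sum.inl ⁻¹' V', Sum.inr ⁻¹' V'⟩ y _ _ hp hlang
        (hA.trans (Set.preimage_mono hV)) hP
    | read => cases h

/-! ### The AllowList theorem -/

theorem mainTheorem2 :
    (∀ (n : ℕ) (par : AllowListParams.{u} n),
      ∃ (B : Type u) (_ : Finite B) (W : B → Type u),
        WaitFreeImplements (fun b => register n (W b)) (allowList par)) ∧
    (∀ (V : Type u) [Nontrivial V] (ι : ℕ → Type w) (par : ∀ n, ι n → AllowListParams.{u} n),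
      consensusNumber V (fun n i => allowList (par n i)) = 1) := by
  exact ⟨fun n par => ⟨ULift (Fin n), inferInstance, fun _ => GrowingSet.Cell _,
    (allowListGrowingSet par).waitFreeImplements AllowListParams.Res.false rfl⟩,
    fun V _ ι par => consensusNumber_eq_one V _ fun n i => allowList_nonInterfering (par n i)⟩
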